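/- **Setting.** Let $\mathcal V_n=\{-1,1\}^n$ with the hypercube graph structure ($x\sim y$ if $x,y$ differ in exactly one coordinate). For each $n$ let $(g_n(x))_{x\in\mathcal V_n}$ be independent standard Gaussian random variables; for all $n$ these are defined on a common probability space $(\Omega,\mathcal F,\mathbb P)$ (no assumption is made on the joint law for different $n$). Fix $c_\star>2$ and, for $n\ge2$, define $u_n$ by $\mathbb P(g_n(x)\le -u_n)=n^{-c_\star}$. Put $w_n(x)=e^{-\beta\sqrt n\,g_n(x)}$, and let $H_n(x)=\sqrt n\,g_n(x)$ if $g_n(x)\le -u_n$ and $H_n(x)=0$ otherwise. Call $x$ occupied if $g_n(x)\le-u_n$; let $\mathcal V_n^\star$ be the set of occupied vertices having at least one occupied neighbour, that is, the union of the connected components $C^\star_{n,l}$ of size at least $2$ of the graph of occupied vertices, and set $\mathcal V_n^\circ=\mathcal V_n\setminus\mathcal V_n^\star$. For a fixed environment let $J_n=(J_n(i))_{i\ge0}$ be the Markov chain on $\mathcal V_n$ started from the uniform distribution on $\mathcal V_n^\circ$, with transition probabilities $p_n(x,y)$, $y\sim x$, proportional to $e^{-\beta[H_n(y)-H_n(x)]^+}$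 (the jump chain of the Metropolis dynamics $X_n$), let $\lambda_n(x)=\frac1n\sum_{y\sim x}e^{-\beta[H_n(y)-H_n(x)]^+}$, and let $(e_{n,i})_{i\ge0}$ be independent mean one exponential random variables, independent of $J_n$. Write $\mathcal P_n$ for the joint law of $J_n$ and $(e_{n,i})$ given the environment. Given sequences $a_n,c_n$, let $K_n(t)$ be the least $k\ge0$ such that exactly $\lfloor a_nt\rfloor$ of $J_n(0),\dots,J_n(k-1)$ lie in $\mathcal V_n^\circ$, and let $T_{n,0}^\circ<T_{n,1}^\circ<\cdots$ be the times of the consecutive visits of $J_n$ to $\mathcal V_n^\circ$. For $t\ge0$ define the rescaled clock process, the rescaled front end clock process and the rescaled time spent in the components $C^\star_{n,l}$ by $$S_n(t)=\frac1{c_n}\sum_{i=0}^{K_n(t)-1}\frac{e_{n,i}}{\lambda_n(J_n(i))},\qquad S_n^\circ(t)=\frac1{c_n}\sum_{j=0}^{\lfloor a_nt\rfloor-1}\frac{e_{n,T^\circ_{n,j}}}{\lambda_n(J_n(T^\circ_{n,j}))},\qquad \widehat S_n(t)=\frac1{c_n}\sum_{i=0}^{K_n(t)-1}\frac{e_{n,i}}{\lambda_n(J_n(i))}\mathbf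 1_{\{J_n(i)\in\mathcal V_n^\star\}}.$$ Let $\rho_\infty$ be the Skorokhod $J_1$ metric on the space $D([0,\infty))$ of càdlàg functions, $\rho_\infty(x,y)=\sum_{m\ge1}2^{-m}\min\{1,d_m(\chi_mx,\chi_my)\}$, where $\chi_m(t)=\max\{0,\min\{1,m-t\}\}$, $d_m(x,y)=\inf_{\Lambda}\max\{\sup_{0\le s<t\le m}|\log\frac{\Lambda t-\Lambda s}{t-s}|,\ \sup_{0\le t\le m}|x(t)-y(\Lambda t)|\}$, and $\Lambda$ ranges over the increasing bijections of $[0,m]$ onto itself. **Theorem 3.3 (Remainder).** Let $c_\star>2$, $0<\varepsilon<1$ and $\beta>\beta_c(\varepsilon)=\sqrt{2\varepsilon\log2}$. Let $a_n$ and $c_n$ be sequences such that $$\lim_{n\to\infty}\frac{\log a_n}{n\log2}=\varepsilon,\qquad \lim_{n\to\infty}a_n\,\mathbb P(w_n(x)\ge c_n)=1 .$$ Then, $\mathbb P$-almost surely, for all $\delta>0$, $$\lim_{n\to\infty}\mathcal P_n\big(\rho_\infty(S_n,S_n^\circ)>\delta\big)=0,$$ and the time spent in the components $C^\star_{n,l}$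 is negligible: for all $t\ge0$ and $\delta>0$, $\lim_{n\to\infty}\mathcal P_n(\widehat S_n(t)>\delta)=0$. -/

import Mathlib

open MeasureTheory ProbabilityTheory Filter Topology Set
open scoped NNReal ENNReal

noncomputable section

namespace TruncatedREM

/-! ### The Skorokhod space `D([0,∞))` and its metric -/

/-- Right-continuous real functions on `[0,∞)` with left limits. -/
def IsCadlag (f : ℝ≥0 → ℝ) : Prop :=
  ∀ t, ContinuousWithinAt f (Ici t) t ∧ ∃ l, Tendsto f (𝓝[<] t) (𝓝 l)

/-- The space `D([0,∞))`. -/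
def SkorokhodSpace : Type := {f : ℝ≥0 → ℝ // IsCadlag f}

/-- Step functions of the form `t ↦ f ⌊a t⌋` are càdlàg. -/
theorem isCadlag_floor (a : ℝ) (f : ℕ → ℝ) :
    IsCadlag (fun t : ℝ≥0 => f ⌊a * (t : ℝ)⌋₊) := by
  intro t
  rcases le_or_gt a 0 with ha | ha
  · have h0 : (fun t : ℝ≥0 => f ⌊a * (t : ℝ)⌋₊) = fun _ => f 0 := by
      funext s
      rw [Nat.floor_of_nonpos (mul_nonpos_of_nonpos_of_nonneg ha s.coe_nonneg)]
    rw [h0]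
    exact ⟨continuousWithinAt_const, f 0, tendsto_const_nhds⟩
  have hcont : Continuous (fun s : ℝ≥0 => a * (s : ℝ)) := by fun_prop
  constructor
  · have h1 : ∀ᶠ s : ℝ≥0 in 𝓝[≥] t, f ⌊a * (t : ℝ)⌋₊ = f ⌊a * (s : ℝ)⌋₊ := by
      have h2 : ∀ᶠ s : ℝ≥0 in 𝓝[≥] t, a * (s : ℝ) < (⌊a * (t : ℝ)⌋₊ : ℝ) + 1 :=
        nhdsWithin_le_nhds ((hcont.tendsto t).eventually
          (eventually_lt_nhds (Nat.lt_floor_add_one _)))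
      filter_upwards [h2, self_mem_nhdsWithin] with s hs hts
      have hts' : (t : ℝ) ≤ s := NNReal.coe_le_coe.mpr hts
      have h3 : ⌊a * (s : ℝ)⌋₊ = ⌊a * (t : ℝ)⌋₊ := by
        rw [Nat.floor_eq_iff (by positivity)]
        exact ⟨(Nat.floor_le (by positivity)).trans (by gcongr), hs⟩
      rw [h3]
    exact tendsto_const_nhds.congr' h1
  · refine ⟨f (⌈a * (t : ℝ)⌉₊ - 1), ?_⟩
    have h1 : ∀ᶠ s : ℝ≥0 in 𝓝[<] t, f (⌈a * (t : ℝ)⌉₊ - 1) = f ⌊a * (s : ℝ)⌋₊ := by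
      have h2 : ∀ᶠ s : ℝ≥0 in 𝓝[<] t, (⌈a * (t : ℝ)⌉₊ : ℝ) - 1 < a * (s : ℝ) :=
        nhdsWithin_le_nhds ((hcont.tendsto t).eventually
          (eventually_gt_nhds (by
            have := Nat.ceil_lt_add_one (a := a * (t : ℝ)) (by positivity)
            linarith)))
      filter_upwards [h2, self_mem_nhdsWithin] with s hs hst
      have hst' : (s : ℝ) < t := NNReal.coe_lt_coe.mpr hst
      have hlt : a * (s : ℝ) < a * t := by gcongr
      have hpos : 1 ≤ ⌈a * (t : ℝ)⌉₊ :=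
        Nat.one_le_ceil_iff.mpr (lt_of_le_of_lt (by positivity) hlt)
      have h3 : ⌊a * (s : ℝ)⌋₊ = ⌈a * (t : ℝ)⌉₊ - 1 := by
        rw [Nat.floor_eq_iff (by positivity)]
        push_cast [hpos]
        exact ⟨hs.le, by linarith [Nat.le_ceil (a * (t : ℝ))]⟩
      rw [h3]
    exact tendsto_const_nhds.congr' h1

/-- The size `sup_{s < t} |log ((Λ t - Λ s) / (t - s))|` of a time change `Λ` of `[0,m]`, that is,
of an increasing bijection of `[0,m]` onto itself. -/
def timeChangeNorm {m : ℝ≥0} (Λ : Icc (0 : ℝ≥0) m ≃o Icc (0 : ℝ≥0) m) : ℝ≥0∞ :=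
  ⨆ (s : Icc (0 : ℝ≥0) m) (t : Icc (0 : ℝ≥0) m) (_ : s < t),
    ENNReal.ofReal |Real.log ((((Λ t : ℝ≥0) : ℝ) - ((Λ s : ℝ≥0) : ℝ)) /
      (((t : ℝ≥0) : ℝ) - ((s : ℝ≥0) : ℝ)))|

/-- Billingsley's (complete) Skorokhod `J₁` metric on `D([0,m])`, applied to the restrictions of
`x` and `y` to `[0,m]`. -/
def skorokhodDistOn (m : ℝ≥0) (x y : ℝ≥0 → ℝ) : ℝ≥0∞ :=
  ⨅ Λ : Icc (0 : ℝ≥0) m ≃o Icc (0 : ℝ≥0) m,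
    max (timeChangeNorm Λ) (⨆ t : Icc (0 : ℝ≥0) m, ENNReal.ofReal |x t - y (Λ t)|)

/-- The continuous cut-off equal to `1` on `[0,m-1]`, to `m - t` on `[m-1,m]`, and to `0` on
`[m,∞)`. -/
def cutoff (m : ℕ) (t : ℝ≥0) : ℝ := max 0 (min 1 ((m : ℝ) - (t : ℝ)))

/-- The Skorokhod `J₁` metric on `D([0,∞))`,
`∑_{m ≥ 1} 2^{-m} (1 ∧ d_m (x^m, y^m))` where `x^m` is `x` multiplied by the `m`-th cut-off and
`d_m` is the Skorokhod metric on `D([0,m])`. -/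
def skorokhodDist (x y : SkorokhodSpace) : ℝ≥0∞ :=
  ∑' k : ℕ, 2⁻¹ ^ (k + 1) *
    min 1 (skorokhodDistOn ((k + 1 : ℕ) : ℝ≥0)
      (fun t => cutoff (k + 1) t * x.1 t) (fun t => cutoff (k + 1) t * y.1 t))

/-! ### The truncated random energy model

Throughout, `γ : Cube n → ℝ` is a realization of the Gaussian environment and `u` is the
truncation level. -/

/-- The cube `{-1,1}^n`. The graph distance `½ ∑ |x i - y i|` is `hammingDist x y`. -/
abbrev Cube (n : ℕ) : Type := Fin n → ℤˣ

instance instMeasurableSingletonClassSign : MeasurableSingletonClass ℤˣ :=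
  ⟨fun x => ⟨{(x : ℤ)}, measurableSet_singleton _, by ext y; simp [Units.ext_iff]⟩⟩

variable {n : ℕ}

/-- Boltzmann weight `exp (-β √n γ x)` of the random energy model without truncation. -/
def boltzmann (β : ℝ) (γ : Cube n → ℝ) (x : Cube n) : ℝ :=
  Real.exp (-β * (√(n : ℝ) * γ x))

open Classical in
/-- The truncated Hamiltonian. -/
def hamiltonian (u : ℝ) (γ : Cube n → ℝ) (x : Cube n) : ℝ :=
  if γ x ≤ -u then √(n : ℝ) * γ x else 0

open Classical in
/-- The occupied vertices. -/
def occupied (u : ℝ) (γ : Cube n → ℝ) : Finset (Cube n) :=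
  Finset.univ.filter fun x => γ x ≤ -u

open Classical in
/-- The isolated occupied vertices. -/
def isolated (u : ℝ) (γ : Cube n → ℝ) : Finset (Cube n) :=
  (occupied u γ).filter fun x => ∀ y, hammingDist x y = 1 → y ∉ occupied u γ

/-- The occupied vertices that are not isolated, i.e. the union of the connected components of
size at least two of the graph of occupied vertices. -/
def clusters (u : ℝ) (γ : Cube n → ℝ) : Finset (Cube n) :=
  occupied u γ \ isolated u γ

/-- The complement of the clusters. -/
def front (u : ℝ) (γ : Cube n → ℝ) : Finset (Cube n) :=
  Finset.univ \ clusters u γ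

/-! ### Metropolis dynamics -/

/-- The factor `exp (-β [H y - H x]⁺)` on the edges of the cube, and `0` elsewhere. -/
def metropolisWeight (β u : ℝ) (γ : Cube n → ℝ) (x y : Cube n) : ℝ :=
  if hammingDist x y = 1 then
    Real.exp (-β * max (hamiltonian u γ y - hamiltonian u γ x) 0) else 0

/-- The holding time parameter `(1/n) ∑_y exp (-β [H y - H x]⁺)`. -/
def holdingRate (β u : ℝ) (γ : Cube n → ℝ) (x : Cube n) : ℝ :=
  (1 / (n : ℝ)) * ∑ y, metropolisWeight β u γ x y

/-- The one-step law of the jump chain from `x`: proportional to `metropolisWeight β u γ x`. Only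
for `n = 0`, where `x` has no neighbour, is the weight identically zero, and then the chain
stays at `x`. -/
def jumpLaw (β u : ℝ) (γ : Cube n → ℝ) (x : Cube n) : PMF (Cube n) :=
  open Classical in
  if h : ∑' y, ENNReal.ofReal (metropolisWeight β u γ x y) ≠ 0 then
    PMF.normalize (fun y => ENNReal.ofReal (metropolisWeight β u γ x y)) h
      (by rw [tsum_fintype]; exact ENNReal.sum_ne_top.mpr fun _ _ => ENNReal.ofReal_ne_top)
  else PMF.pure x

/-- The transition kernel of the jump chain. -/
def jumpKernel (β u : ℝ) (γ : Cube n → ℝ) : Kernel (Cube n) (Cube n) :=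
  Kernel.ofFunOfCountable fun x => (jumpLaw β u γ x).toMeasure

instance instIsMarkovKernelJumpKernel (β u : ℝ) (γ : Cube n → ℝ) : IsMarkovKernel (jumpKernel β u γ) :=
  ⟨fun x => inferInstanceAs (IsProbabilityMeasure (jumpLaw β u γ x).toMeasure)⟩

/-- The law on path space of the jump chain started from the uniform distribution on
`front u γ`. -/
def jumpChainLaw (β u : ℝ) (γ : Cube n → ℝ) : Measure (ℕ → Cube n) :=
  Kernel.trajMeasure (X := fun _ => Cube n) (uniformOn (front u γ : Set (Cube n)))
    (fun k => (jumpKernel β u γ).comap (fun h : (i : Finset.Iic k) → Cube n =>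
      h ⟨k, Finset.mem_Iic.mpr le_rfl⟩) (measurable_pi_apply _))

/-- For a fixed environment, the joint law of the jump chain and of an independent sequence of
independent mean one exponential variables. -/
def dynamicsLaw (β u : ℝ) (γ : Cube n → ℝ) : Measure ((ℕ → Cube n) × (ℕ → ℝ)) :=
  (jumpChainLaw β u γ).prod (Measure.infinitePi fun _ => expMeasure 1)

/-! ### Clock processes

In what follows `J` is a trajectory of the jump chain and `e` a sequence of exponential
variables. -/

/-- `∑_{i < k} λ(J i)⁻¹ e i`. -/
def clock (β u : ℝ) (γ : Cube n → ℝ) (J : ℕ → Cube n) (e : ℕ → ℝ) (k : ℕ) : ℝ :=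
  ∑ i ∈ Finset.range k, (holdingRate β u γ (J i))⁻¹ * e i

/-- The least number of steps in which `J` makes `m` visits to `front u γ`
(in particular `0` if `m = 0`). -/
def stepsFor (u : ℝ) (γ : Cube n → ℝ) (J : ℕ → Cube n) (m : ℕ) : ℕ :=
  sInf {k | Nat.count (fun i => J i ∈ front u γ) k = m}

/-- The rescaled clock process. -/
def rescaledClock (β u a c : ℝ) (γ : Cube n → ℝ) (η : (ℕ → Cube n) × (ℕ → ℝ)) :
    SkorokhodSpace :=
  ⟨fun t => c⁻¹ * clock β u γ η.1 η.2 (stepsFor u γ η.1 ⌊a * (t : ℝ)⌋₊),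
    isCadlag_floor a fun m => c⁻¹ * clock β u γ η.1 η.2 (stepsFor u γ η.1 m)⟩

/-- The times `T 0 < T 1 < …` of the consecutive visits of `J` to `front u γ`. -/
def frontTime (u : ℝ) (γ : Cube n → ℝ) (J : ℕ → Cube n) (j : ℕ) : ℕ :=
  Nat.nth (fun i => J i ∈ front u γ) j

/-- The rescaled front end clock process: the clock of the chain `j ↦ J (T j)`, whose `j`-th step
uses the exponential variable `e (T j)` of the corresponding step of `J`, so that it records the
time spent in `front u γ`. -/
def rescaledFrontClock (β u a c : ℝ) (γ : Cube n → ℝ) (η : (ℕ → Cube n) × (ℕ → ℝ)) :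
    SkorokhodSpace :=
  ⟨fun t => c⁻¹ * clock β u γ (fun j => η.1 (frontTime u γ η.1 j))
      (fun j => η.2 (frontTime u γ η.1 j)) ⌊a * (t : ℝ)⌋₊,
    isCadlag_floor a fun m => c⁻¹ * clock β u γ (fun j => η.1 (frontTime u γ η.1 j))
      (fun j => η.2 (frontTime u γ η.1 j)) m⟩

/-- The rescaled time spent in the clusters along the first `stepsFor u γ J ⌊a t⌋` steps. -/
def clusterTime (β u a c : ℝ) (γ : Cube n → ℝ) (η : (ℕ → Cube n) × (ℕ → ℝ)) (t : ℝ≥0) : ℝ :=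
  c⁻¹ * ∑ i ∈ Finset.range (stepsFor u γ η.1 ⌊a * (t : ℝ)⌋₊),
    if η.1 i ∈ clusters u γ then (holdingRate β u γ (η.1 i))⁻¹ * η.2 i else 0

/-- The critical inverse temperature. -/
def betaC (ε : ℝ) : ℝ := √(ε * 2 * Real.log 2)

end TruncatedREM

end

open TruncatedREM

/-!
Idea of the proof: since `H = 0` off the occupied vertices, the jump chain is reversible with
respect to `ν x = exp (-β H x) λ x`, which is the counting measure on the front. As the initial
law is at most `ν / |front|` and this measure is invariant, every excursion from the front,
whatever its index, has mean occupation measure at most `ν / |front|`. During `m` excursions the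
chain therefore enters a union `B` of clusters with probability at most `m |B| / |front|`, and
collects in the other clusters a mean time of at most `m / |front|` times their total Boltzmann
weight, because the mean holding time `1 / λ` cancels the factor `λ` of `ν`.

Take for `B` the clusters that contain a vertex of Boltzmann weight at least `c`. Their size is
bounded by the number of occupied paths starting at such a vertex, whose mean is controlled by a
geometric series in `n P(occupied) = n ^ (1 - c⋆)`. The total weight of the other clusters has
mean at most `2 ^ n n ^ (1 - c⋆)` times the Gaussian weight truncated at `c`, and `β > β_c` makes
this truncated mean of order `c / a`, that is, `c P(w ≥ c)`. Since `n ^ (1 - c⋆)` is summable,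
both errors tend to `0` almost surely. Finally the clock exceeds the front end clock exactly by
the time spent in the clusters, so the two are uniformly close on bounded time intervals, hence
close for the Skorokhod metric.
-/

noncomputable section

namespace TruncatedREM

/-! ### Excursions of a Markov chain -/

section MarkovChain

variable {E : Type*} [MeasurableSpace E]

theorem kernel_comp_sum (κ : Kernel E E) {ι : Type*} (s : Finset ι) (μ : ι → Measure E) :
    κ ∘ₘ (∑ i ∈ s, μ i) = ∑ i ∈ s, κ ∘ₘ μ i := by
  induction s using Finset.cons_induction with
  | empty => simp
  | cons i s hi ih => simp [ih]

theorem kernel_comp_mono (κ : Kernel E E) {μ ν : Measure E} (h : μ ≤ ν) : κ ∘ₘ μ ≤ κ ∘ₘ ν :=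
  Measure.le_iff.mpr fun B hB => by
    rw [Measure.bind_apply hB κ.aemeasurable, Measure.bind_apply hB κ.aemeasurable]
    exact lintegral_mono' h le_rfl

/-- The law on path space of the Markov chain with initial law `μ₀` and transition kernel `κ`. -/
def chainLaw (μ₀ : Measure E) (κ : Kernel E E) [IsMarkovKernel κ] : Measure (ℕ → E) :=
  Kernel.trajMeasure (X := fun _ => E) μ₀ fun k =>
    κ.comap (fun h : Finset.Iic k → E => h ⟨k, Finset.mem_Iic.mpr le_rfl⟩) (measurable_pi_apply _)

/-- The number of visits to `F` of the path `J` before time `k`. -/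
def visits (F : Set E) [DecidablePred (· ∈ F)] (J : ℕ → E) (k : ℕ) : ℕ :=
  Nat.count (fun i => J i ∈ F) k

theorem measurable_eval_piLE {i k : ℕ} (hik : i ≤ k) :
    Measurable[Filtration.piLE (X := fun _ => E) k] fun J : ℕ → E => J i := by
  rw [Filtration.piLE_eq_comap_frestrictLe]
  exact (measurable_pi_apply ⟨i, Finset.mem_Iic.mpr hik⟩).comp
    (comap_measurable (Preorder.frestrictLe (π := fun _ => E) k))

theorem measurable_visits_piLE {F : Set E} [DecidablePred (· ∈ F)] (hF : MeasurableSet F) (k : ℕ) :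
    Measurable[Filtration.piLE (X := fun _ => E) k] fun J : ℕ → E => visits F J k := by
  suffices ∀ i ≤ k, Measurable[Filtration.piLE (X := fun _ => E) k]
      fun J : ℕ → E => visits F J i from this k le_rfl
  intro i hi
  induction i with
  | zero => exact measurable_const
  | succ i ih =>
    simp only [visits, Nat.count_succ] at ih ⊢
    exact (ih (by lia)).add <|
      .ite (measurable_eval_piLE (by lia) hF) measurable_const measurable_const

theorem measurable_visits {F : Set E} [DecidablePred (· ∈ F)] (hF : MeasurableSet F) (k : ℕ) :
    Measurable fun J : ℕ → E => visits F J k :=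
  (measurable_visits_piLE hF k).mono (Filtration.piLE.le k) le_rfl

variable (μ₀ : Measure E) (κ : Kernel E E) [IsMarkovKernel κ]

instance instIsProbabilityMeasureChainLaw [IsProbabilityMeasure μ₀] :
    IsProbabilityMeasure (chainLaw μ₀ κ) := by
  unfold chainLaw; infer_instance

theorem map_zero_chainLaw : (chainLaw μ₀ κ).map (fun J => J 0) = μ₀ := by
  have h1 : (fun J : ℕ → E => J 0) =
      MeasurableEquiv.piUnique (fun _ : Finset.Iic 0 => E) ∘
        Preorder.frestrictLe (π := fun _ => E) 0 := rfl
  rw [h1, ← Measure.map_map (by fun_prop) (by fun_prop), chainLaw, Kernel.trajMeasure,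
    Measure.map_comp _ _ (by fun_prop), Kernel.traj_map_frestrictLe, Kernel.partialTraj_self,
    Measure.id_comp, Measure.map_map (by fun_prop) (by fun_prop),
    MeasurableEquiv.self_comp_symm, Measure.map_id]

theorem chainLaw_inter_eval_succ [IsProbabilityMeasure μ₀] {k : ℕ} {A : Set (ℕ → E)}
    (hA : MeasurableSet[Filtration.piLE (X := fun _ => E) k] A) {B : Set E}
    (hB : MeasurableSet B) :
    chainLaw μ₀ κ (A ∩ {J | J (k + 1) ∈ B}) = ∫⁻ J in A, κ (J k) B ∂chainLaw μ₀ κ := by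
  rw [Filtration.piLE_eq_comap_frestrictLe] at hA
  obtain ⟨S, hS, rfl⟩ := hA
  have joint := congrArg (fun ρ : Measure _ => ρ (S ×ˢ B)) <|
    Kernel.map_frestrictLe_trajMeasure_compProd_eq_map_trajMeasure (X := fun _ => E) (μ₀ := μ₀)
      (κ := fun k => κ.comap (fun h : Finset.Iic k → E => h ⟨k, Finset.mem_Iic.mpr le_rfl⟩)
        (measurable_pi_apply _)) (a := k)
  rw [Measure.compProd_apply_prod hS hB, Measure.map_apply (by fun_prop) (hS.prod hB),
    setLIntegral_map hS (Kernel.measurable_coe _ hB) (by fun_prop)] at joint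
  exact joint.symm

theorem map_succ_restrict_chainLaw [IsProbabilityMeasure μ₀] {k : ℕ} {A : Set (ℕ → E)}
    (hA : MeasurableSet[Filtration.piLE (X := fun _ => E) k] A) :
    ((chainLaw μ₀ κ).restrict A).map (fun J => J (k + 1)) =
      κ ∘ₘ ((chainLaw μ₀ κ).restrict A).map (fun J => J k) := by
  ext B hB
  rw [Measure.map_apply (by fun_prop) hB, Measure.restrict_apply (hB.preimage (by fun_prop)),
    Measure.bind_apply hB κ.aemeasurable,
    lintegral_map (κ.measurable_coe hB) (by fun_prop), inter_comm,
    ← chainLaw_inter_eval_succ μ₀ κ hA hB]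
  rfl

variable (F : Set E) [DecidablePred (· ∈ F)]

/-- The law of the chain at time `i`, restricted to the event that `F` was visited `j` times before
time `i`. -/
def occupation (i j : ℕ) : Measure E :=
  ((chainLaw μ₀ κ).restrict {J | visits F J i = j}).map fun J => J i

variable {κ F}

theorem occupation_zero_zero : occupation μ₀ κ F 0 0 = μ₀ := by
  simp [occupation, visits, map_zero_chainLaw]

theorem occupation_zero_succ (j : ℕ) : occupation μ₀ κ F 0 (j + 1) = 0 := by
  simp [occupation, visits]

variable {μ₀}

theorem occupation_succ_zero (hμ₀ : μ₀ Fᶜ = 0) (i : ℕ) :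
    occupation μ₀ κ F (i + 1) 0 = 0 := by
  have hstart : ∀ᵐ J ∂chainLaw μ₀ κ, J 0 ∈ F := by
    rw [← map_zero_chainLaw μ₀ κ] at hμ₀
    exact ae_of_ae_map (measurable_pi_apply 0).aemeasurable (mem_ae_iff.mpr hμ₀)
  have hnull : ∀ᵐ J ∂chainLaw μ₀ κ, ¬ visits F J (i + 1) = 0 := by
    filter_upwards [hstart] with J h0 hJ
    exact Nat.count_iff_forall_not.mp hJ 0 i.succ_pos h0
  rw [occupation, Measure.restrict_eq_zero.mpr (by simpa [ae_iff] using hnull), Measure.map_zero]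

variable [IsProbabilityMeasure μ₀]

theorem occupation_succ_succ (hF : MeasurableSet F) (i j : ℕ) :
    occupation μ₀ κ F (i + 1) (j + 1) =
      κ ∘ₘ ((occupation μ₀ κ F i j).restrict F + (occupation μ₀ κ F i (j + 1)).restrict Fᶜ) := by
  have hV := measurable_visits_piLE (E := E) hF i
  have hJ := measurable_eval_piLE (E := E) (le_refl i)
  have split : {J : ℕ → E | visits F J (i + 1) = j + 1} =
      (fun J => J i) ⁻¹' F ∩ {J | visits F J i = j} ∪
        (fun J => J i) ⁻¹' Fᶜ ∩ {J | visits F J i = j + 1} := by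
    ext J
    by_cases h : J i ∈ F <;> simp [visits, Nat.count_succ, h]
  have hdisj : Disjoint ((fun J : ℕ → E => J i) ⁻¹' F ∩ {J | visits F J i = j})
      ((fun J => J i) ⁻¹' Fᶜ ∩ {J | visits F J i = j + 1}) :=
    (disjoint_compl_right.preimage _).mono inter_subset_left inter_subset_left
  have hin : MeasurableSet[Filtration.piLE (X := fun _ => E) i]
      ((fun J : ℕ → E => J i) ⁻¹' F ∩ {J | visits F J i = j}) :=
    (hJ hF).inter (hV (measurableSet_singleton j))
  have hout : MeasurableSet[Filtration.piLE (X := fun _ => E) i]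
      ((fun J : ℕ → E => J i) ⁻¹' Fᶜ ∩ {J | visits F J i = j + 1}) :=
    (hJ hF.compl).inter (hV (measurableSet_singleton (j + 1)))
  simp only [occupation]
  rw [split, Measure.restrict_union hdisj (Filtration.piLE.le i _ hout),
    Measure.map_add _ _ (by fun_prop), map_succ_restrict_chainLaw μ₀ κ hin,
    map_succ_restrict_chainLaw μ₀ κ hout, Measure.comp_add,
    Measure.restrict_map (by fun_prop) hF, Measure.restrict_map (by fun_prop) hF.compl,
    Measure.restrict_restrict (hF.preimage (by fun_prop)),
    Measure.restrict_restrict (hF.compl.preimage (by fun_prop))]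

variable {ν : Measure E}

/-- For fixed `j`, the sum over all `i` is the mean occupation measure of the `j`-th excursion. -/
theorem sum_occupation_le (hF : MeasurableSet F) (hμ₀ : μ₀ Fᶜ = 0) (hμν : μ₀ ≤ ν)
    (hν : κ ∘ₘ ν ≤ ν) (N j : ℕ) : ∑ i ∈ Finset.range N, occupation μ₀ κ F i j ≤ ν := by
  induction N generalizing j with
  | zero => simpa using Measure.zero_le ν
  | succ N ih =>
    rw [Finset.sum_range_succ']
    cases j with
    | zero => simpa [occupation_succ_zero hμ₀, occupation_zero_zero] using hμν
    | succ j =>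
      simp only [occupation_zero_succ, add_zero, occupation_succ_succ hF, ← kernel_comp_sum]
      refine (kernel_comp_mono κ ?_).trans hν
      calc ∑ i ∈ Finset.range N, ((occupation μ₀ κ F i j).restrict F +
            (occupation μ₀ κ F i (j + 1)).restrict Fᶜ)
          = (∑ i ∈ Finset.range N, occupation μ₀ κ F i j).restrict F +
            (∑ i ∈ Finset.range N, occupation μ₀ κ F i (j + 1)).restrict Fᶜ := by
            simp only [← Measure.restrictₗ_apply, map_sum, Finset.sum_add_distrib]
        _ ≤ ν.restrict F + ν.restrict Fᶜ := by
            gcongr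
            · exact ih j
            · exact ih (j + 1)
        _ = ν := Measure.restrict_add_restrict_compl hF

theorem tsum_setLIntegral_visits_lt_le (hF : MeasurableSet F) (hμ₀ : μ₀ Fᶜ = 0) (hμν : μ₀ ≤ ν)
    (hν : κ ∘ₘ ν ≤ ν) (m : ℕ) {φ : E → ℝ≥0∞} (hφ : Measurable φ) :
    ∑' i, ∫⁻ J in {J | visits F J i < m}, φ (J i) ∂chainLaw μ₀ κ ≤ m * ∫⁻ x, φ x ∂ν := by
  have split (i : ℕ) : ∫⁻ J in {J | visits F J i < m}, φ (J i) ∂chainLaw μ₀ κ =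
      ∑ j ∈ Finset.range m, ∫⁻ x, φ x ∂occupation μ₀ κ F i j := by
    have hset : {J : ℕ → E | visits F J i < m} =
        ⋃ j ∈ Finset.range m, {J | visits F J i = j} := by ext J; simp
    rw [hset, lintegral_biUnion_finset]
    · exact Finset.sum_congr rfl fun j _ => (lintegral_map hφ (measurable_pi_apply i)).symm
    · exact fun j _ l _ hjl => disjoint_left.mpr fun J hj hl => hjl (hj.symm.trans hl)
    · exact fun j _ => measurable_visits hF i (measurableSet_singleton j)
  refine ENNReal.tsum_le_of_sum_range_le fun N => ?_
  calc ∑ i ∈ Finset.range N, ∫⁻ J in {J | visits F J i < m}, φ (J i) ∂chainLaw μ₀ κ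
      = ∑ j ∈ Finset.range m, ∫⁻ x, φ x ∂∑ i ∈ Finset.range N, occupation μ₀ κ F i j := by
        simp only [split, lintegral_finsetSum_measure]
        exact Finset.sum_comm
    _ ≤ ∑ _j ∈ Finset.range m, ∫⁻ x, φ x ∂ν :=
        Finset.sum_le_sum fun j _ => lintegral_mono' (sum_occupation_le hF hμ₀ hμν hν N j) le_rfl
    _ = m * ∫⁻ x, φ x ∂ν := by simp

theorem measure_exists_mem_visits_lt_le (hF : MeasurableSet F) (hμ₀ : μ₀ Fᶜ = 0) (hμν : μ₀ ≤ ν)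
    (hν : κ ∘ₘ ν ≤ ν) (m : ℕ) {B : Set E} (hB : MeasurableSet B) (hBF : Disjoint B F) :
    chainLaw μ₀ κ {J | ∃ i, visits F J i < m ∧ J i ∈ B} ≤ m * ∫⁻ x in Bᶜ, κ x B ∂ν := by
  have hstart : chainLaw μ₀ κ {J | J 0 ∈ B} = 0 := by
    rw [← map_zero_chainLaw μ₀ κ, Measure.map_apply (by fun_prop) hF.compl] at hμ₀
    exact measure_mono_null (fun J hJ => hBF.notMem_of_mem_left hJ) hμ₀
  have entrance (i : ℕ) :
      chainLaw μ₀ κ ({J | J i ∈ Bᶜ ∧ visits F J i < m} ∩ {J | J (i + 1) ∈ B}) =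
        ∫⁻ J in {J | visits F J i < m}, Bᶜ.indicator (κ · B) (J i) ∂chainLaw μ₀ κ := by
    have hA : MeasurableSet[Filtration.piLE (X := fun _ => E) i]
        {J : ℕ → E | J i ∈ Bᶜ ∧ visits F J i < m} :=
      (measurable_eval_piLE (le_refl i) hB.compl).inter
        (measurable_visits_piLE hF i measurableSet_Iio)
    rw [chainLaw_inter_eval_succ μ₀ κ hA hB]
    have hpre : MeasurableSet {J : ℕ → E | J i ∈ Bᶜ} := hB.compl.preimage (by fun_prop)
    exact (Measure.restrict_restrict hpre ▸ lintegral_indicator hpre _).symm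
  have hsub : {J : ℕ → E | ∃ i, visits F J i < m ∧ J i ∈ B} ⊆
      {J | J 0 ∈ B} ∪ ⋃ i, {J | J i ∈ Bᶜ ∧ visits F J i < m} ∩ {J | J (i + 1) ∈ B} := by
    classical
    intro J hJ
    obtain ⟨hi, hmin⟩ := Nat.find_spec hJ, fun k => Nat.find_min hJ (m := k)
    generalize Nat.find hJ = i at hi hmin
    cases i with
    | zero => exact .inl hi.2
    | succ k =>
      have hk : visits F J k < m := (Nat.count_monotone _ k.le_succ).trans_lt hi.1
      exact .inr (mem_iUnion.mpr ⟨k, ⟨fun hB => hmin k k.lt_succ_self ⟨hk, hB⟩, hk⟩, hi.2⟩)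
  calc chainLaw μ₀ κ {J | ∃ i, visits F J i < m ∧ J i ∈ B}
      ≤ chainLaw μ₀ κ {J | J 0 ∈ B} +
          ∑' i, chainLaw μ₀ κ ({J | J i ∈ Bᶜ ∧ visits F J i < m} ∩ {J | J (i + 1) ∈ B}) :=
        (measure_mono hsub).trans <| (measure_union_le _ _).trans <|
          by gcongr; exact measure_iUnion_le _
    _ ≤ m * ∫⁻ x in Bᶜ, κ x B ∂ν := by
        simp only [hstart, zero_add, entrance, ← lintegral_indicator hB.compl]
        exact tsum_setLIntegral_visits_lt_le hF hμ₀ hμν hν m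
          ((κ.measurable_coe hB).indicator hB.compl)

omit [DecidablePred (· ∈ F)] in
theorem ae_infinite_visits [IsFiniteMeasure ν] (hF : MeasurableSet F) (hμ₀ : μ₀ Fᶜ = 0)
    (hμν : μ₀ ≤ ν) (hν : κ ∘ₘ ν ≤ ν) : ∀ᵐ J ∂chainLaw μ₀ κ, {i | J i ∈ F}.Infinite := by
  classical
  have hsum (m : ℕ) : ∑' i, chainLaw μ₀ κ {J | visits F J i < m} ≤ m * ν univ := by
    simpa using tsum_setLIntegral_visits_lt_le hF hμ₀ hμν hν m measurable_one
  have hvisits : ∀ᵐ J ∂chainLaw μ₀ κ, ∀ m, ∃ k, m ≤ visits F J k := by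
    refine ae_all_iff.mpr fun m => ?_
    filter_upwards [ae_eventually_notMem (ne_top_of_le_ne_top (by finiteness) (hsum m))] with J hJ
    exact hJ.exists.imp fun k hk => not_lt.mp hk
  filter_upwards [hvisits] with J hJ hfin
  obtain ⟨k, hk⟩ := hJ (hfin.toFinset.card + 1)
  exact absurd (Nat.count_le_card (p := fun i => J i ∈ F) hfin k) (by simpa [visits] using hk)

end MarkovChain

section WeightedTime

/-- The `φ`-weighted time before the `m`-th visit to `F` if the `i`-th step lasts `|e i|`. -/
def weightedTime {E : Type*} (F : Set E) [DecidablePred (· ∈ F)] (φ : E → ℝ≥0∞) (m : ℕ)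
    (η : (ℕ → E) × (ℕ → ℝ)) : ℝ≥0∞ :=
  ∑' i, {J | visits F J i < m}.indicator (fun J => φ (J i)) η.1 * ‖η.2 i‖ₑ

variable {E : Type*} {F : Set E} [DecidablePred (· ∈ F)] {φ : E → ℝ≥0∞}

theorem weightedTime_mono {m m' : ℕ} (h : m ≤ m') (η : (ℕ → E) × (ℕ → ℝ)) :
    weightedTime F φ m η ≤ weightedTime F φ m' η := by
  refine ENNReal.tsum_le_tsum fun i => mul_le_mul_left ?_ _
  exact indicator_le_indicator_of_subset (fun J hJ => lt_of_lt_of_le hJ h) (fun _ => zero_le) _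

theorem weightedTime_eq_of_avoids {B : Set E} {m : ℕ} {η : (ℕ → E) × (ℕ → ℝ)}
    (h : ∀ i, visits F η.1 i < m → η.1 i ∉ B) :
    weightedTime F φ m η = weightedTime F (Bᶜ.indicator φ) m η := by
  refine tsum_congr fun i => congrArg (· * _) ?_
  by_cases hi : visits F η.1 i < m
  · have hB : η.1 i ∈ Bᶜ := h i hi
    simp [hi, hB]
  · simp [hi]

variable [MeasurableSpace E]

theorem measurable_weightedTime_term (hF : MeasurableSet F) (hφ : Measurable φ) (m i : ℕ) :
    Measurable ({J : ℕ → E | visits F J i < m}.indicator fun J => φ (J i)) :=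
  (hφ.comp (measurable_pi_apply i)).indicator (measurable_visits hF i measurableSet_Iio)

theorem measurable_weightedTime (hF : MeasurableSet F) (hφ : Measurable φ) (m : ℕ) :
    Measurable (weightedTime F φ m) :=
  .tsum fun i => ((measurable_weightedTime_term hF hφ m i).comp measurable_fst).mul <| by fun_prop

variable {μ₀ ν : Measure E} {κ : Kernel E E} [IsMarkovKernel κ]
  (τ : Measure ℝ) [IsProbabilityMeasure τ]

theorem lintegral_weightedTime (hF : MeasurableSet F) (hφ : Measurable φ) (m : ℕ) :
    ∫⁻ η, weightedTime F φ m η ∂(chainLaw μ₀ κ).prod (Measure.infinitePi fun _ => τ) =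
      (∑' i, ∫⁻ J in {J | visits F J i < m}, φ (J i) ∂chainLaw μ₀ κ) * ∫⁻ x, ‖x‖ₑ ∂τ := by
  have hterm := measurable_weightedTime_term hF hφ m
  have hhold (i : ℕ) : ∫⁻ e : ℕ → ℝ, ‖e i‖ₑ ∂Measure.infinitePi (fun _ => τ) = ∫⁻ x, ‖x‖ₑ ∂τ :=
    (measurePreserving_eval_infinitePi (fun _ => τ) i).lintegral_comp measurable_enorm
  have hbefore (i : ℕ) : MeasurableSet {J : ℕ → E | visits F J i < m} :=
    measurable_visits hF i measurableSet_Iio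
  simp only [weightedTime]
  rw [lintegral_tsum, ← ENNReal.tsum_mul_right]
  · refine tsum_congr fun i => ?_
    rw [← hhold i, ← lintegral_indicator (hbefore i)]
    exact lintegral_prod_mul (hterm i).aemeasurable
      (measurable_pi_apply i).enorm.aemeasurable
  · exact fun i => (((hterm i).comp measurable_fst).mul (by fun_prop)).aemeasurable

variable [IsProbabilityMeasure μ₀]

theorem measure_lt_weightedTime_le (hF : MeasurableSet F) (hμ₀ : μ₀ Fᶜ = 0) (hμν : μ₀ ≤ ν)
    (hν : κ ∘ₘ ν ≤ ν) (hφ : Measurable φ) (m : ℕ) {B : Set E} (hB : MeasurableSet B)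
    (hBF : Disjoint B F) {r : ℝ≥0∞} (hr0 : r ≠ 0) (hr : r ≠ ∞) :
    (chainLaw μ₀ κ).prod (Measure.infinitePi fun _ => τ) {η | r < weightedTime F φ m η} ≤
      m * ∫⁻ x in Bᶜ, κ x B ∂ν + m * (∫⁻ x in Bᶜ, φ x ∂ν) * (∫⁻ x, ‖x‖ₑ ∂τ) / r := by
  set ρ := (chainLaw μ₀ κ).prod (Measure.infinitePi fun _ : ℕ => τ)
  set entering := {J : ℕ → E | ∃ i, visits F J i < m ∧ J i ∈ B}
  have hsub : {η | r < weightedTime F φ m η} ⊆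
      entering ×ˢ univ ∪ {η | r ≤ weightedTime F (Bᶜ.indicator φ) m η} := by
    intro η hη
    by_cases h : η.1 ∈ entering
    · exact .inl ⟨h, mem_univ _⟩
    · refine .inr (le_of_lt hη |>.trans_eq (weightedTime_eq_of_avoids ?_))
      exact fun i hi hB => h ⟨i, hi, hB⟩
  calc ρ {η | r < weightedTime F φ m η}
      ≤ ρ (entering ×ˢ univ) + ρ {η | r ≤ weightedTime F (Bᶜ.indicator φ) m η} :=
        (measure_mono hsub).trans (measure_union_le _ _)
    _ ≤ chainLaw μ₀ κ entering + (∫⁻ η, weightedTime F (Bᶜ.indicator φ) m η ∂ρ) / r := by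
        gcongr
        · simp [ρ, Measure.prod_prod]
        · exact meas_ge_le_lintegral_div
            (measurable_weightedTime hF (hφ.indicator hB.compl) m).aemeasurable hr0 hr
    _ ≤ _ := by
        gcongr
        · exact measure_exists_mem_visits_lt_le hF hμ₀ hμν hν m hB hBF
        · rw [lintegral_weightedTime τ hF (hφ.indicator hB.compl), ← lintegral_indicator hB.compl]
          gcongr
          exact tsum_setLIntegral_visits_lt_le hF hμ₀ hμν hν m (hφ.indicator hB.compl)

end WeightedTime

theorem integrable_id_expMeasure {r : ℝ} (hr : 0 < r) : Integrable id (expMeasure r) := by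
  have hdensity : expMeasure r = volume.withDensity (exponentialPDF r) := rfl
  rw [hdensity, integrable_withDensity_iff (f := exponentialPDF r)
    (measurable_exponentialPDFReal r).ennreal_ofReal (ae_of_all _ fun _ => ENNReal.ofReal_lt_top)]
  have hgamma : IntegrableOn (fun x : ℝ => r * (x ^ (1 : ℝ) * Real.exp (-r * x ^ (1 : ℝ))))
      (Ioi 0) := (integrableOn_rpow_mul_exp_neg_mul_rpow (by norm_num) one_pos hr).const_mul r
  refine (hgamma.integrable_indicator measurableSet_Ioi).congr (ae_of_all _ fun x => ?_)
  change _ = x * (exponentialPDF r x).toReal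
  rcases lt_trichotomy x 0 with hx | rfl | hx
  · simp [exponentialPDF_of_neg hx, hx.le]
  · simp
  · simp only [indicator_of_mem (mem_Ioi.mpr hx), exponentialPDF_of_nonneg hx.le, Real.rpow_one,
      ENNReal.toReal_ofReal (by positivity : 0 ≤ r * Real.exp (-(r * x))), neg_mul]
    ring

/-! ### The Skorokhod distance between the clock processes -/

section Skorokhod

theorem timeChangeNorm_refl (m : ℝ≥0) :
    timeChangeNorm (OrderIso.refl (Icc (0 : ℝ≥0) m)) = 0 := by
  simp only [timeChangeNorm, ENNReal.iSup_eq_zero, OrderIso.refl_apply]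
  intro s t hst
  have h : ((t : ℝ≥0) : ℝ) - ((s : ℝ≥0) : ℝ) ≠ 0 :=
    sub_ne_zero.mpr (NNReal.coe_lt_coe.mpr hst).ne'
  simp [div_self h]

theorem skorokhodDistOn_le {m : ℝ≥0} {x y : ℝ≥0 → ℝ} {b : ℝ≥0∞}
    (h : ∀ t ≤ m, ENNReal.ofReal |x t - y t| ≤ b) : skorokhodDistOn m x y ≤ b := by
  refine (iInf_le _ (OrderIso.refl _)).trans ?_
  rw [timeChangeNorm_refl]
  exact max_le zero_le (iSup_le fun t => h t t.2.2)

theorem abs_cutoff_mul_sub_le (m : ℕ) (t : ℝ≥0) (x y : ℝ) :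
    |cutoff m t * x - cutoff m t * y| ≤ |x - y| := by
  have h0 : 0 ≤ cutoff m t := le_max_left _ _
  have h1 : cutoff m t ≤ 1 := max_le zero_le_one (min_le_left _ _)
  rw [← mul_sub, abs_mul, abs_of_nonneg h0]
  exact mul_le_of_le_one_left (abs_nonneg _) h1

theorem skorokhodDist_le {x y : SkorokhodSpace} {M : ℕ} {b : ℝ≥0∞}
    (h : ∀ t : ℝ≥0, t ≤ M → ENNReal.ofReal |x.1 t - y.1 t| ≤ b) :
    skorokhodDist x y ≤ b + 2⁻¹ ^ M := by
  have hgeom : ∑' k : ℕ, (2⁻¹ : ℝ≥0∞) ^ (k + 1) = 1 := by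
    rw [ENNReal.tsum_geometric_add_one, ENNReal.one_sub_inv_two,
      ENNReal.mul_inv_cancel (by simp) (by simp)]
  rw [skorokhodDist, ← Summable.sum_add_tsum_nat_add' (k := M) ENNReal.summable]
  refine add_le_add ?_ ?_
  · calc _ ≤ ∑ k ∈ Finset.range M, 2⁻¹ ^ (k + 1) * b := by
          refine Finset.sum_le_sum fun k hk => ?_
          gcongr
          refine (min_le_right _ _).trans <| skorokhodDistOn_le fun t ht => ?_
          refine (ENNReal.ofReal_le_ofReal (abs_cutoff_mul_sub_le _ _ _ _)).trans (h t ?_)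
          exact ht.trans (Nat.cast_le.mpr (Finset.mem_range.mp hk))
      _ ≤ ∑' k : ℕ, 2⁻¹ ^ (k + 1) * b := ENNReal.sum_le_tsum _
      _ = b := by rw [ENNReal.tsum_mul_right, hgeom, one_mul]
  · calc _ ≤ ∑' k : ℕ, (2⁻¹ : ℝ≥0∞) ^ M * 2⁻¹ ^ (k + 1) := by
          refine ENNReal.tsum_le_tsum fun k => ?_
          rw [← pow_add, add_left_comm, ← add_assoc]
          exact mul_le_of_le_one_right' (min_le_left _ _)
      _ = 2⁻¹ ^ M := by rw [ENNReal.tsum_mul_left, hgeom, mul_one]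

end Skorokhod

section Clock

theorem sum_ite_range_eq_sum_nth {M : Type*} [AddCommMonoid M] (p : ℕ → Prop) [DecidablePred p]
    (f : ℕ → M) (k : ℕ) :
    ∑ i ∈ Finset.range k, (if p i then f i else 0) =
      ∑ j ∈ Finset.range (Nat.count p k), f (Nat.nth p j) := by
  induction k with
  | zero => simp
  | succ k ih =>
    rw [Finset.sum_range_succ, ih, Nat.count_succ]
    split_ifs with h
    · rw [Finset.sum_range_succ, Nat.nth_count h]
    · simp

variable {n : ℕ} {u : ℝ} {γ : Cube n → ℝ}

theorem visits_lt_of_lt_stepsFor {J : ℕ → Cube n} {m i : ℕ} (h : i < stepsFor u γ J m) :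
    visits (front u γ) J i < m := by
  set p := fun i => J i ∈ front u γ
  have hne (k : ℕ) (hk : k ≤ i) : k ∉ {k | Nat.count p k = m} :=
    Nat.notMem_of_lt_sInf (hk.trans_lt h)
  by_contra! hle
  rcases hle.eq_or_lt with heq | hlt
  · exact hne i le_rfl heq.symm
  · exact hne _ (Nat.nth_lt_of_lt_count hlt).le <|
      Nat.count_nth fun hfin => hlt.trans_le (Nat.count_le_card hfin i)

theorem count_stepsFor {J : ℕ → Cube n} (hJ : {i | J i ∈ front u γ}.Infinite) (m : ℕ) :
    Nat.count (fun i => J i ∈ front u γ) (stepsFor u γ J m) = m :=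
  Nat.sInf_mem (s := {k | Nat.count (fun i => J i ∈ front u γ) k = m})
    ⟨Nat.nth (fun i => J i ∈ front u γ) m, Nat.count_nth_of_infinite hJ m⟩

variable {β a c : ℝ}

theorem rescaledClock_sub_rescaledFrontClock {η : (ℕ → Cube n) × (ℕ → ℝ)}
    (hη : {i | η.1 i ∈ front u γ}.Infinite) (t : ℝ≥0) :
    (rescaledClock β u a c γ η).1 t - (rescaledFrontClock β u a c γ η).1 t =
      clusterTime β u a c γ η t := by
  have hfront := sum_ite_range_eq_sum_nth (fun i => η.1 i ∈ front u γ)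
    (fun i => (holdingRate β u γ (η.1 i))⁻¹ * η.2 i) (stepsFor u γ η.1 ⌊a * (t : ℝ)⌋₊)
  rw [count_stepsFor hη] at hfront
  simp only [rescaledClock, rescaledFrontClock, clusterTime, clock, frontTime]
  rw [← mul_sub, ← hfront, ← Finset.sum_sub_distrib]
  congr 1
  refine Finset.sum_congr rfl fun i _ => ?_
  by_cases hi : η.1 i ∈ clusters u γ <;> simp [front, hi]

/-- The unscaled time spent in the clusters before the `m`-th visit to the front. -/
def clusterOccupation (β u : ℝ) (γ : Cube n → ℝ) (m : ℕ) (η : (ℕ → Cube n) × (ℕ → ℝ)) : ℝ≥0∞ :=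
  weightedTime (front u γ : Set (Cube n))
    ((clusters u γ : Set (Cube n)).indicator fun x => ‖(holdingRate β u γ x)⁻¹‖ₑ) m η

theorem enorm_clusterTime_le (η : (ℕ → Cube n) × (ℕ → ℝ)) (t : ℝ≥0) :
    ‖clusterTime β u a c γ η t‖ₑ ≤ ‖c⁻¹‖ₑ * clusterOccupation β u γ ⌊a * (t : ℝ)⌋₊ η := by
  rw [clusterTime, enorm_mul]
  gcongr
  refine (enorm_sum_le _ _).trans <| (Finset.sum_le_sum fun i hi => ?_).trans <|
    ENNReal.sum_le_tsum (Finset.range (stepsFor u γ η.1 ⌊a * (t : ℝ)⌋₊))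
  have hvisits := visits_lt_of_lt_stepsFor (Finset.mem_range.mp hi)
  split_ifs with hcluster <;> simp [hvisits, hcluster, enorm_mul]

theorem abs_clusterTime_le (hc : 0 < c) {δ : ℝ} (hδ : 0 ≤ δ) {η : (ℕ → Cube n) × (ℕ → ℝ)}
    {t : ℝ≥0} (h : clusterOccupation β u γ ⌊a * (t : ℝ)⌋₊ η ≤ ENNReal.ofReal (c * δ)) :
    |clusterTime β u a c γ η t| ≤ δ := by
  rw [← ENNReal.ofReal_le_ofReal_iff hδ, ← Real.enorm_eq_ofReal_abs]
  calc ‖clusterTime β u a c γ η t‖ₑ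
      ≤ ENNReal.ofReal c⁻¹ * ENNReal.ofReal (c * δ) := by
        rw [← Real.enorm_eq_ofReal (by positivity : 0 ≤ c⁻¹)]
        exact (enorm_clusterTime_le η t).trans (by gcongr)
    _ = ENNReal.ofReal δ := by
        rw [← ENNReal.ofReal_mul (by positivity), inv_mul_cancel_left₀ hc.ne']

theorem skorokhodDist_rescaledClock_le (ha : 0 ≤ a) (hc : 0 < c) {δ : ℝ} (hδ : 0 ≤ δ) {M : ℕ}
    {η : (ℕ → Cube n) × (ℕ → ℝ)} (hη : {i | η.1 i ∈ front u γ}.Infinite)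
    (h : clusterOccupation β u γ ⌊a * (M : ℝ)⌋₊ η ≤ ENNReal.ofReal (c * δ)) :
    skorokhodDist (rescaledClock β u a c γ η) (rescaledFrontClock β u a c γ η) ≤
      ENNReal.ofReal δ + 2⁻¹ ^ M := by
  refine skorokhodDist_le fun t ht => ENNReal.ofReal_le_ofReal ?_
  rw [rescaledClock_sub_rescaledFrontClock hη]
  have htM : (t : ℝ) ≤ M := by exact_mod_cast ht
  exact abs_clusterTime_le hc hδ ((weightedTime_mono (by gcongr) η).trans h)

end Clock

/-! ### Reversibility of the jump chain -/

section CubeGraph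

/-- The nearest neighbour graph of the cube. -/
def cubeGraph (n : ℕ) : SimpleGraph (Cube n) where
  Adj x y := hammingDist x y = 1
  symm := ⟨fun x y h => by rwa [hammingDist_comm]⟩
  loopless := ⟨fun x h => by simp at h⟩

variable {n : ℕ}

instance instDecidableRelCubeGraphAdj : DecidableRel (cubeGraph n).Adj :=
  fun x y => inferInstanceAs (Decidable (hammingDist x y = 1))

theorem cubeGraph_adj_iff {x y : Cube n} :
    (cubeGraph n).Adj x y ↔ ∃ i, Function.update x i (-x i) = y := by
  have hflip (a b : ℤˣ) : a ≠ b ↔ -a = b := by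
    rcases Int.units_eq_one_or a with rfl | rfl <;>
      rcases Int.units_eq_one_or b with rfl | rfl <;> decide
  change hammingDist x y = 1 ↔ _
  rw [hammingDist, Finset.card_eq_one]
  refine exists_congr fun i => ?_
  simp only [Finset.ext_iff, Finset.mem_filter, Finset.mem_univ, true_and, Finset.mem_singleton,
    funext_iff]
  refine forall_congr' fun j => ?_
  rcases eq_or_ne j i with rfl | hji
  · simpa using hflip (x j) (y j)
  · simp [hji]

theorem cubeGraph_isRegularOfDegree (n : ℕ) : (cubeGraph n).IsRegularOfDegree n := by
  intro x
  have hinj : Function.Injective fun i => Function.update x i (-x i) := by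
    intro i j hij
    by_contra hne
    simpa [hne, neg_units_ne_self] using congrFun hij i
  have himage : (cubeGraph n).neighborFinset x =
      Finset.univ.image fun i => Function.update x i (-x i) := by
    ext y
    simp [cubeGraph_adj_iff]
  rw [← SimpleGraph.card_neighborFinset_eq_degree, himage, Finset.card_image_of_injective _ hinj,
    Finset.card_fin]

end CubeGraph

section Metropolis

theorem isReversible_of_singleton {E : Type*} [MeasurableSpace E] [Countable E]
    [MeasurableSingletonClass E] {κ : Kernel E E} {ν : Measure E}
    (h : ∀ x y, κ x {y} * ν {x} = κ y {x} * ν {y}) : κ.IsReversible ν := by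
  have flow (A B : Set E) : ∫⁻ x in A, κ x B ∂ν =
      ∑' x, ∑' y, A.indicator 1 x * B.indicator 1 y * (κ x {y} * ν {x}) := by
    rw [← lintegral_indicator A.to_countable.measurableSet, lintegral_countable']
    refine tsum_congr fun x => ?_
    by_cases hx : x ∈ A
    · rw [indicator_of_mem hx,
        ← Measure.tsum_indicator_apply_singleton (κ x) B B.to_countable.measurableSet]
      simp only [hx, indicator_of_mem, Pi.one_apply, one_mul, ← ENNReal.tsum_mul_right]
      refine tsum_congr fun y => ?_
      by_cases hy : y ∈ B <;> simp [hy]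
    · simp [hx]
  intro A B _ _
  rw [flow, flow, ENNReal.tsum_comm]
  simp only [h, mul_comm (A.indicator 1 _)]

variable {n : ℕ} {β u : ℝ} {γ : Cube n → ℝ}

theorem mem_occupied {x : Cube n} : x ∈ occupied u γ ↔ γ x ≤ -u := by simp [occupied]

theorem mem_clusters {x : Cube n} :
    x ∈ clusters u γ ↔ x ∈ occupied u γ ∧ ∃ y, (cubeGraph n).Adj x y ∧ y ∈ occupied u γ := by
  simp +contextual [clusters, isolated, cubeGraph]

theorem disjoint_clusters_front : Disjoint (clusters u γ) (front u γ) :=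
  Finset.disjoint_sdiff

theorem hamiltonian_of_mem {x : Cube n} (hx : x ∈ occupied u γ) :
    hamiltonian u γ x = √(n : ℝ) * γ x :=
  if_pos (mem_occupied.mp hx)

theorem hamiltonian_of_notMem {x : Cube n} (hx : x ∉ occupied u γ) : hamiltonian u γ x = 0 :=
  if_neg (mem_occupied.not.mp hx)

theorem hamiltonian_nonpos (hu : 0 ≤ u) (x : Cube n) : hamiltonian u γ x ≤ 0 := by
  by_cases hx : x ∈ occupied u γ
  · rw [hamiltonian_of_mem hx]
    exact mul_nonpos_of_nonneg_of_nonpos (Real.sqrt_nonneg _) (by linarith [mem_occupied.mp hx])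
  · rw [hamiltonian_of_notMem hx]

theorem metropolisWeight_nonneg (x y : Cube n) : 0 ≤ metropolisWeight β u γ x y := by
  unfold metropolisWeight
  split_ifs <;> positivity

theorem sum_metropolisWeight_pos (hn : 0 < n) (x : Cube n) :
    0 < ∑ y, metropolisWeight β u γ x y := by
  have hdegree : 0 < (cubeGraph n).degree x := by rwa [cubeGraph_isRegularOfDegree n x]
  obtain ⟨y, hxy⟩ := ((cubeGraph n).degree_pos_iff_exists_adj x).mp hdegree
  refine Finset.sum_pos' (fun y _ => metropolisWeight_nonneg x y) ⟨y, Finset.mem_univ y, ?_⟩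
  rw [metropolisWeight, if_pos (show hammingDist x y = 1 from hxy)]
  positivity

theorem jumpKernel_singleton (hn : 0 < n) (x y : Cube n) :
    jumpKernel β u γ x {y} =
      ENNReal.ofReal (metropolisWeight β u γ x y / ∑ z, metropolisWeight β u γ x z) := by
  have hpos := sum_metropolisWeight_pos (β := β) (u := u) (γ := γ) hn x
  have hsum : ∑' z, ENNReal.ofReal (metropolisWeight β u γ x z) =
      ENNReal.ofReal (∑ z, metropolisWeight β u γ x z) := by
    rw [tsum_fintype, ENNReal.ofReal_sum_of_nonneg fun z _ => metropolisWeight_nonneg x z]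
  have hne : ∑' z, ENNReal.ofReal (metropolisWeight β u γ x z) ≠ 0 := by
    rw [hsum]
    exact (ENNReal.ofReal_pos.mpr hpos).ne'
  change (jumpLaw β u γ x).toMeasure {y} = _
  rw [PMF.toMeasure_apply_singleton _ _ (measurableSet_singleton y), jumpLaw, dif_pos hne,
    PMF.normalize_apply, hsum, ENNReal.ofReal_div_of_pos hpos, div_eq_mul_inv]

/-- The conductance of the pair `x, y`: the symmetric edge weight of the electrical network whose
random walk is the jump chain. -/
def conductance (β u : ℝ) (γ : Cube n → ℝ) (x y : Cube n) : ℝ :=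
  if (cubeGraph n).Adj x y then
    Real.exp (-β * max (hamiltonian u γ x) (hamiltonian u γ y)) else 0

theorem conductance_comm (x y : Cube n) : conductance β u γ x y = conductance β u γ y x := by
  simp only [conductance, SimpleGraph.adj_comm _ x y, max_comm]

theorem exp_mul_metropolisWeight (x y : Cube n) :
    Real.exp (-β * hamiltonian u γ x) * metropolisWeight β u γ x y = conductance β u γ x y := by
  rw [metropolisWeight, conductance, mul_ite, mul_zero, ← Real.exp_add, ← mul_add,
    ← max_add_add_left]
  simp [cubeGraph, max_comm]

/-- The reversible measure `exp (-β H x) λ x` of the jump chain. It has density `1` on the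
front. -/
def reversibleMeasure (β u : ℝ) (γ : Cube n → ℝ) : Measure (Cube n) :=
  Measure.count.withDensity fun x =>
    ENNReal.ofReal (Real.exp (-β * hamiltonian u γ x) * holdingRate β u γ x)

theorem reversibleMeasure_singleton (x : Cube n) : reversibleMeasure β u γ {x} =
    ENNReal.ofReal (Real.exp (-β * hamiltonian u γ x) * holdingRate β u γ x) := by
  simp [reversibleMeasure, withDensity_apply]

theorem jumpKernel_mul_reversibleMeasure (hn : 0 < n) (x y : Cube n) :
    jumpKernel β u γ x {y} * reversibleMeasure β u γ {x} =
      ENNReal.ofReal (conductance β u γ x y / n) := by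
  have hpos := sum_metropolisWeight_pos (β := β) (u := u) (γ := γ) hn x
  have hweight := metropolisWeight_nonneg (β := β) (u := u) (γ := γ) x y
  rw [jumpKernel_singleton hn, reversibleMeasure_singleton, ← ENNReal.ofReal_mul (by positivity),
    ← exp_mul_metropolisWeight, holdingRate]
  congr 1
  field_simp

theorem isReversible_jumpKernel (hn : 0 < n) :
    (jumpKernel β u γ).IsReversible (reversibleMeasure β u γ) :=
  isReversible_of_singleton fun x y => by
    simp only [jumpKernel_mul_reversibleMeasure hn, conductance_comm]

theorem conductance_eq_one (hu : 0 ≤ u) {x y : Cube n} (hxy : (cubeGraph n).Adj x y)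
    (h : x ∈ occupied u γ → y ∉ occupied u γ) : conductance β u γ x y = 1 := by
  have hx := hamiltonian_nonpos (γ := γ) hu x
  have hy := hamiltonian_nonpos (γ := γ) hu y
  rw [conductance, if_pos hxy]
  by_cases hmem : x ∈ occupied u γ
  · simp [hamiltonian_of_notMem (h hmem), hx]
  · simp [hamiltonian_of_notMem hmem, hy]

theorem reversibleMeasure_singleton_of_mem_front (hn : 0 < n) (hu : 0 ≤ u) {x : Cube n}
    (hx : x ∈ front u γ) : reversibleMeasure β u γ {x} = 1 := by
  have hunit (y : Cube n) :
      conductance β u γ x y = if (cubeGraph n).Adj x y then 1 else 0 := by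
    split_ifs with hxy
    · exact conductance_eq_one hu hxy fun hx' hy =>
        Finset.disjoint_right.mp disjoint_clusters_front hx (mem_clusters.mpr ⟨hx', y, hxy, hy⟩)
    · exact if_neg hxy
  have hdegree : ∑ y, conductance β u γ x y = n := by
    simp only [hunit, Finset.sum_boole, ← SimpleGraph.neighborFinset_eq_filter,
      SimpleGraph.card_neighborFinset_eq_degree, cubeGraph_isRegularOfDegree n x]
  rw [reversibleMeasure_singleton, holdingRate, mul_left_comm, Finset.mul_sum]
  simp only [exp_mul_metropolisWeight, hdegree]
  simp [hn.ne']

theorem uniformOn_front_le (hn : 0 < n) (hu : 0 ≤ u) :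
    uniformOn (front u γ : Set (Cube n)) ≤
      ((front u γ).card : ℝ≥0∞)⁻¹ • reversibleMeasure β u γ := by
  rw [uniformOn, ProbabilityTheory.cond, Measure.count_apply_finset]
  gcongr
  calc Measure.count.restrict (front u γ : Set (Cube n))
      = (reversibleMeasure β u γ).restrict (front u γ) := by
        refine Measure.ext_of_singleton fun x => ?_
        rw [Measure.restrict_apply (by simp), Measure.restrict_apply (by simp)]
        by_cases hx : x ∈ front u γ
        · rw [inter_eq_left.mpr (by simpa using hx), Measure.count_singleton,
            reversibleMeasure_singleton_of_mem_front hn hu hx]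
        · simp [hx]
    _ ≤ reversibleMeasure β u γ := Measure.restrict_le_self

theorem setLIntegral_compl_jumpKernel_le (hn : 0 < n) (hu : 0 ≤ u) {B : Finset (Cube n)}
    (hclosed : ∀ z ∈ B, ∀ x, (cubeGraph n).Adj z x → x ∈ occupied u γ → x ∈ B) :
    ∫⁻ x in (B : Set (Cube n))ᶜ, jumpKernel β u γ x B ∂reversibleMeasure β u γ ≤ B.card := by
  -- Only edges of conductance `1` leave a union of components of the occupied graph.
  have hexit (z : Cube n) (hz : z ∈ B) (x : Cube n) (hx : x ∈ Bᶜ) :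
      conductance β u γ z x = if (cubeGraph n).Adj z x then 1 else 0 := by
    split_ifs with hzx
    · exact conductance_eq_one hu hzx fun _ hx' =>
        Finset.mem_compl.mp hx (hclosed z hz x hzx hx')
    · exact if_neg hzx
  have hrate (z : Cube n) (hz : z ∈ B) :
      jumpKernel β u γ z (B : Set (Cube n))ᶜ * reversibleMeasure β u γ {z} ≤ 1 := by
    rw [← Finset.coe_compl, ← sum_measure_singleton, Finset.sum_mul]
    simp only [jumpKernel_mul_reversibleMeasure hn]
    calc ∑ x ∈ Bᶜ, ENNReal.ofReal (conductance β u γ z x / n)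
        = ∑ x ∈ Bᶜ, if (cubeGraph n).Adj z x then (n : ℝ≥0∞)⁻¹ else 0 := by
          refine Finset.sum_congr rfl fun x hx => ?_
          rw [hexit z hz x hx]
          split_ifs <;> simp [ENNReal.ofReal_inv_of_pos, hn]
      _ ≤ ∑ x, if (cubeGraph n).Adj z x then (n : ℝ≥0∞)⁻¹ else 0 :=
          Finset.sum_le_sum_of_subset (Finset.subset_univ _)
      _ = 1 := by
          rw [← Finset.sum_filter, ← SimpleGraph.neighborFinset_eq_filter, Finset.sum_const,
            SimpleGraph.card_neighborFinset_eq_degree, cubeGraph_isRegularOfDegree n z,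
            nsmul_eq_mul, ENNReal.mul_inv_cancel (by simpa using hn.ne') (by simp)]
  calc ∫⁻ x in (B : Set (Cube n))ᶜ, jumpKernel β u γ x B ∂reversibleMeasure β u γ
      = ∫⁻ z in B, jumpKernel β u γ z (B : Set (Cube n))ᶜ ∂reversibleMeasure β u γ :=
        isReversible_jumpKernel hn B.measurableSet.compl B.measurableSet
    _ = ∑ z ∈ B, jumpKernel β u γ z (B : Set (Cube n))ᶜ * reversibleMeasure β u γ {z} :=
        lintegral_finset _ _
    _ ≤ ∑ z ∈ B, 1 := Finset.sum_le_sum hrate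
    _ = B.card := by simp

theorem holdingRate_pos (hn : 0 < n) (x : Cube n) : 0 < holdingRate β u γ x :=
  mul_pos (by positivity) (sum_metropolisWeight_pos hn x)

theorem setLIntegral_compl_inv_holdingRate (hn : 0 < n) (B : Finset (Cube n)) :
    ∫⁻ x in (B : Set (Cube n))ᶜ, (clusters u γ : Set (Cube n)).indicator
        (fun x => ‖(holdingRate β u γ x)⁻¹‖ₑ) x ∂reversibleMeasure β u γ =
      ∑ x ∈ clusters u γ \ B, ENNReal.ofReal (boltzmann β γ x) := by
  rw [setLIntegral_indicator (clusters u γ).measurableSet, ← sdiff_eq, ← Finset.coe_sdiff,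
    lintegral_finset]
  refine Finset.sum_congr rfl fun x hx => ?_
  have hoccupied := (mem_clusters.mp (Finset.mem_sdiff.mp hx).1).1
  have hrate := holdingRate_pos (β := β) (u := u) (γ := γ) hn x
  rw [reversibleMeasure_singleton, Real.enorm_eq_ofReal (by positivity),
    ← ENNReal.ofReal_mul (by positivity), hamiltonian_of_mem hoccupied, boltzmann]
  congr 1
  field_simp

end Metropolis

section Dynamics

variable {n : ℕ} {β u : ℝ} {γ : Cube n → ℝ}

theorem isProbabilityMeasure_uniformOn_front (hfront : (front u γ).Nonempty) :
    IsProbabilityMeasure (uniformOn (front u γ : Set (Cube n))) :=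
  isProbabilityMeasure_uniformOn (Finset.finite_toSet _) (by simpa using hfront)

theorem uniformOn_front_compl : uniformOn (front u γ : Set (Cube n)) (front u γ)ᶜ = 0 := by
  rw [uniformOn, cond_apply (Finset.measurableSet _)]
  simp

theorem jumpKernel_comp_smul_reversibleMeasure (hn : 0 < n) (r : ℝ≥0∞) :
    jumpKernel β u γ ∘ₘ (r • reversibleMeasure β u γ) = r • reversibleMeasure β u γ := by
  rw [Measure.comp_smul, (isReversible_jumpKernel hn).invariant.def]

theorem dynamicsLaw_lt_clusterOccupation_le (hn : 0 < n) (hu : 0 ≤ u)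
    (hfront : (front u γ).Nonempty) {B : Finset (Cube n)} (hB : B ⊆ clusters u γ)
    (hclosed : ∀ z ∈ B, ∀ x, (cubeGraph n).Adj z x → x ∈ occupied u γ → x ∈ B) (m : ℕ)
    {r : ℝ≥0∞} (hr0 : r ≠ 0) (hr : r ≠ ∞) :
    dynamicsLaw β u γ {η | r < clusterOccupation β u γ m η} ≤
      m * (((front u γ).card : ℝ≥0∞)⁻¹ * B.card) +
        m * (((front u γ).card : ℝ≥0∞)⁻¹ *
          ∑ x ∈ clusters u γ \ B, ENNReal.ofReal (boltzmann β γ x)) *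
          (∫⁻ x, ‖x‖ₑ ∂expMeasure 1) / r := by
  have := isProbabilityMeasure_uniformOn_front hfront
  have := isProbabilityMeasure_expMeasure one_pos
  have hdisjoint : Disjoint (B : Set (Cube n)) (front u γ) :=
    Finset.disjoint_coe.mpr (disjoint_clusters_front.mono_left hB)
  refine (measure_lt_weightedTime_le (expMeasure 1) (front u γ).measurableSet
    uniformOn_front_compl (uniformOn_front_le hn hu)
    (jumpKernel_comp_smul_reversibleMeasure hn _).le .of_discrete m B.measurableSet hdisjoint
    hr0 hr).trans ?_
  rw [Measure.restrict_smul, lintegral_smul_measure, lintegral_smul_measure, smul_eq_mul,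
    smul_eq_mul, setLIntegral_compl_inv_holdingRate hn]
  gcongr
  exact setLIntegral_compl_jumpKernel_le hn hu hclosed

theorem ae_dynamicsLaw_infinite_front (hn : 0 < n) (hu : 0 ≤ u) (hfront : (front u γ).Nonempty) :
    ∀ᵐ η ∂dynamicsLaw β u γ, {i | η.1 i ∈ front u γ}.Infinite := by
  have := isProbabilityMeasure_uniformOn_front hfront
  have := isProbabilityMeasure_expMeasure one_pos
  have : IsFiniteMeasure (reversibleMeasure β u γ) :=
    isFiniteMeasure_withDensity (by simp [lintegral_fintype])
  have : IsFiniteMeasure (((front u γ).card : ℝ≥0∞)⁻¹ • reversibleMeasure β u γ) :=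
    Measure.smul_finite _ (by simpa using hfront.ne_empty)
  exact Measure.quasiMeasurePreserving_fst.ae <|
    ae_infinite_visits (front u γ).measurableSet uniformOn_front_compl (uniformOn_front_le hn hu)
      (jumpKernel_comp_smul_reversibleMeasure hn _).le

end Dynamics

/-! ### Sums over neighbours and over paths -/

section NeighbourSums

variable {V S : Type*} [Fintype V] {G : SimpleGraph V} [DecidableRel G.Adj] {d : ℕ}

variable (G) in
/-- The sum of `f (γ x) * h (γ y)` over the darts `(x, y)` of the graph. -/
def adjSum (f h : S → ℝ≥0∞) (γ : V → S) : ℝ≥0∞ :=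
  ∑ x, ∑ y ∈ G.neighborFinset x, f (γ x) * h (γ y)

variable [MeasurableSpace S] {f h : S → ℝ≥0∞}

theorem measurable_adjSum (hf : Measurable f) (hh : Measurable h) : Measurable (adjSum G f h) := by
  unfold adjSum
  fun_prop

theorem lintegral_adjSum (μ : Measure S) [IsProbabilityMeasure μ] (hG : G.IsRegularOfDegree d)
    (hf : Measurable f) (hh : Measurable h) :
    ∫⁻ γ, adjSum G f h γ ∂Measure.pi (fun _ => μ) =
      Fintype.card V * ((∫⁻ s, f s ∂μ) * (d * ∫⁻ s, h s ∂μ)) := by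
  have hsite (x : V) {f : S → ℝ≥0∞} (hf : Measurable f) :
      ∫⁻ γ, f (γ x) ∂Measure.pi (fun _ => μ) = ∫⁻ s, f s ∂μ :=
    (measurePreserving_eval _ x).lintegral_comp hf
  have hedge (x y : V) (hxy : y ∈ G.neighborFinset x) :
      ∫⁻ γ, f (γ x) * h (γ y) ∂Measure.pi (fun _ => μ) = (∫⁻ s, f s ∂μ) * ∫⁻ s, h s ∂μ := by
    have hindep := (iIndepFun_pi (X := fun _ => id) (μ := fun _ : V => μ)
      (fun _ => aemeasurable_id)).indepFun (G.ne_of_adj ((G.mem_neighborFinset x y).mp hxy))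
    rw [← hsite x hf, ← hsite y hh]
    exact lintegral_mul_eq_lintegral_mul_lintegral_of_indepFun (by fun_prop) (by fun_prop)
      (hindep.comp hf hh)
  unfold adjSum
  rw [lintegral_finsetSum _ (by fun_prop)]
  have hvertex (x : V) : ∫⁻ γ, ∑ y ∈ G.neighborFinset x, f (γ x) * h (γ y)
      ∂Measure.pi (fun _ => μ) = (∫⁻ s, f s ∂μ) * (d * ∫⁻ s, h s ∂μ) := by
    rw [lintegral_finsetSum _ (by fun_prop), Finset.sum_congr rfl (hedge x), Finset.sum_const,
      SimpleGraph.card_neighborFinset_eq_degree, hG x, nsmul_eq_mul, mul_left_comm]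
  simp [hvertex]

end NeighbourSums

section Paths

variable {V S : Type*} [Fintype V] [DecidableEq V] {G : SimpleGraph V} [DecidableRel G.Adj] {d : ℕ}
  {A B : Set S}

theorem sum_card_finsetWalkLength (hG : G.IsRegularOfDegree d) (k : ℕ) (x : V) :
    ∑ z, (G.finsetWalkLength k x z).card = d ^ k := by
  have hcard (k : ℕ) (x z : V) : (G.finsetWalkLength k x z).card = (G.adjMatrix ℕ ^ k) x z := by
    rw [SimpleGraph.adjMatrix_pow_apply_eq_card_walk, Nat.cast_id,
      SimpleGraph.card_set_walk_length_eq]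
  simp only [hcard]
  induction k generalizing x with
  | zero => simp [Matrix.one_apply]
  | succ k ih =>
    simp only [pow_succ', SimpleGraph.adjMatrix_mul_apply]
    rw [Finset.sum_comm]
    simp [ih, hG x]

theorem sum_path_pow_length_le_sum_walk {x z : V} (hxz : x ≠ z) (q : ℝ≥0∞) :
    ∑ p : G.Path x z, q ^ p.1.length ≤
      ∑ k ∈ Finset.range (Fintype.card V), (G.finsetWalkLength (k + 1) x z).card * q ^ (k + 1) := by
  have hmaps (p : G.Path x z) (_ : p ∈ Finset.univ) :
      p.1.length - 1 ∈ Finset.range (Fintype.card V) :=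
    Finset.mem_range.mpr ((Nat.sub_le _ _).trans_lt p.2.length_lt)
  have hpos (p : G.Path x z) : p.1.length - 1 + 1 = p.1.length :=
    Nat.sub_add_cancel <| Nat.one_le_iff_ne_zero.mpr fun h =>
      hxz (SimpleGraph.Walk.eq_of_length_eq_zero h)
  rw [← Finset.sum_fiberwise_of_maps_to hmaps]
  refine Finset.sum_le_sum fun k _ => ?_
  rw [Finset.sum_congr rfl (g := fun _ => q ^ (k + 1)), Finset.sum_const, nsmul_eq_mul]
  · gcongr
    refine Finset.card_le_card_of_injOn Subtype.val (fun p hp => ?_)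
      Subtype.val_injective.injOn
    rw [Finset.mem_coe, SimpleGraph.mem_finsetWalkLength_iff, ← hpos, (Finset.mem_filter.mp hp).2]
  · intro p hp
    rw [← hpos, (Finset.mem_filter.mp hp).2]

theorem sum_path_pow_length_le (hG : G.IsRegularOfDegree d) {q : ℝ≥0∞} (hq : d * q ≤ 2⁻¹) (x : V) :
    ∑ z ∈ Finset.univ.erase x, ∑ p : G.Path x z, q ^ p.1.length ≤ 2 * (d * q) := by
  calc ∑ z ∈ Finset.univ.erase x, ∑ p : G.Path x z, q ^ p.1.length
      ≤ ∑ z, ∑ k ∈ Finset.range (Fintype.card V),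
          (G.finsetWalkLength (k + 1) x z).card * q ^ (k + 1) :=
        (Finset.sum_le_sum fun z hz =>
          sum_path_pow_length_le_sum_walk (Finset.ne_of_mem_erase hz).symm q).trans
          (Finset.sum_le_sum_of_subset (Finset.erase_subset _ _))
    _ = ∑ k ∈ Finset.range (Fintype.card V), d * q * (d * q) ^ k := by
        rw [Finset.sum_comm]
        refine Finset.sum_congr rfl fun k _ => ?_
        rw [← Finset.sum_mul, ← Nat.cast_sum, sum_card_finsetWalkLength hG, Nat.cast_pow, ← mul_pow,
          pow_succ']
    _ ≤ d * q * ∑' k : ℕ, 2⁻¹ ^ k := by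
        rw [← Finset.mul_sum]
        gcongr
        exact (Finset.sum_le_sum fun k _ => by gcongr).trans (ENNReal.sum_le_tsum _)
    _ = 2 * (d * q) := by
        rw [ENNReal.tsum_geometric, ENNReal.one_sub_inv_two, inv_inv, mul_comm]

variable (G) in
/-- The number of paths from `x` to `z` such that, for the assignment `γ` of values to the sites,
the value at `x` lies in `A` and the values at the other sites of the path lie in `B`. -/
def pathCountBetween (A B : Set S) (γ : V → S) (x z : V) : ℝ≥0∞ :=
  ∑ p : G.Path x z,
    ((p.1.support.toFinset : Set V).pi (Function.update (fun _ => B) x A)).indicator 1 γ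

variable (G) in
/-- The number of paths with at least one step that start in a site with value in `A` and continue
through sites with values in `B`. -/
def pathCount (A B : Set S) (γ : V → S) : ℝ≥0∞ :=
  ∑ x, ∑ z ∈ Finset.univ.erase x, pathCountBetween G A B γ x z

theorem one_le_pathCountBetween {γ : V → S} {x z : V} (hx : γ x ∈ A) (p : G.Walk x z)
    (hp : ∀ y ∈ p.support, γ y ∈ B) : 1 ≤ pathCountBetween G A B γ x z := by
  have hmem : γ ∈ (p.toPath.1.support.toFinset : Set V).pi (Function.update (fun _ => B) x A) := by
    intro y hy
    rcases eq_or_ne y x with rfl | hyx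
    · simpa
    · simpa [hyx] using hp y (p.support_toPath_subset_support (by simpa using hy))
  calc (1 : ℝ≥0∞) = ((p.toPath.1.support.toFinset : Set V).pi
        (Function.update (fun _ => B) x A)).indicator 1 γ := by
        rw [indicator_of_mem hmem, Pi.one_apply]
    _ ≤ pathCountBetween G A B γ x z :=
        Finset.single_le_sum (f := fun p : G.Path x z => ((p.1.support.toFinset : Set V).pi
          (Function.update (fun _ => B) x A)).indicator 1 γ)
          (fun _ _ => zero_le) (Finset.mem_univ p.toPath)

theorem card_le_two_mul_pathCount {γ : V → S} {s : Finset V}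
    (hs : ∀ z ∈ s, ∃ x y, x ≠ y ∧ (z = x ∨ z = y) ∧ γ x ∈ A ∧
      ∃ p : G.Walk x y, ∀ v ∈ p.support, γ v ∈ B) :
    (s.card : ℝ≥0∞) ≤ 2 * pathCount G A B γ := by
  set N := pathCountBetween G A B γ
  have hone (z : V) (hz : z ∈ s) :
      1 ≤ ∑ y ∈ Finset.univ.erase z, N z y + ∑ x ∈ Finset.univ.erase z, N x z := by
    obtain ⟨x, y, hxy, rfl | rfl, hx, p, hp⟩ := hs z hz
    · exact (one_le_pathCountBetween hx p hp).trans <| le_add_right <|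
        Finset.single_le_sum (f := N z) (fun _ _ => zero_le) (by simpa using hxy.symm)
    · exact (one_le_pathCountBetween hx p hp).trans <| le_add_left <|
        Finset.single_le_sum (f := fun x => N x z) (fun _ _ => zero_le) (by simpa using hxy)
  have hswap : ∑ z, ∑ x ∈ Finset.univ.erase z, N x z = pathCount G A B γ :=
    Finset.sum_comm' (by simp [eq_comm])
  calc (s.card : ℝ≥0∞) = ∑ z ∈ s, 1 := by simp
    _ ≤ ∑ z ∈ s, (∑ y ∈ Finset.univ.erase z, N z y + ∑ x ∈ Finset.univ.erase z, N x z) :=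
        Finset.sum_le_sum hone
    _ ≤ ∑ z, (∑ y ∈ Finset.univ.erase z, N z y + ∑ x ∈ Finset.univ.erase z, N x z) :=
        Finset.sum_le_sum_of_subset s.subset_univ
    _ = 2 * pathCount G A B γ := by
        rw [Finset.sum_add_distrib, hswap, two_mul]
        rfl

end Paths

section PathMoments

variable {V S : Type*} [DecidableEq V] [MeasurableSpace S] {A B : Set S}

theorem measurableSet_pi_update (hA : MeasurableSet A) (hB : MeasurableSet B) (s : Finset V)
    (x : V) : MeasurableSet ((s : Set V).pi (Function.update (fun _ => B) x A)) := by
  refine MeasurableSet.pi s.countable_toSet fun y _ => ?_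
  rcases eq_or_ne y x with rfl | hyx
  · simpa
  · simpa [hyx]

variable [Fintype V] {G : SimpleGraph V} (μ : Measure S) [IsProbabilityMeasure μ]

theorem pi_pi_update_support {x z : V} (p : G.Path x z) (hA : MeasurableSet A)
    (hB : MeasurableSet B) : Measure.pi (fun _ => μ)
      ((p.1.support.toFinset : Set V).pi (Function.update (fun _ => B) x A)) =
      μ A * μ B ^ p.1.length := by
  have hcard : (p.1.support.toFinset \ {x}).card = p.1.length := by
    rw [Finset.card_sdiff_of_subset (by simp), List.toFinset_card_of_nodup p.2.support_nodup]
    simp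
  rw [← Measure.infinitePi_eq_pi, Measure.infinitePi_pi]
  · simp only [Function.apply_update fun _ => μ]
    rw [Finset.prod_update_of_mem (by simp), Finset.prod_const, hcard]
  · intro y _
    rcases eq_or_ne y x with rfl | hyx
    · simpa
    · simpa [hyx]

variable [DecidableRel G.Adj]

theorem measurable_pathCount (hA : MeasurableSet A) (hB : MeasurableSet B) :
    Measurable (pathCount G A B) :=
  Finset.measurable_fun_sum _ fun _ _ => Finset.measurable_fun_sum _ fun _ _ =>
    Finset.measurable_fun_sum _ fun _ _ =>
      measurable_one.indicator (measurableSet_pi_update hA hB _ _)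

theorem lintegral_pathCount_le {d : ℕ} (hG : G.IsRegularOfDegree d) (hA : MeasurableSet A)
    (hB : MeasurableSet B) (hd : d * μ B ≤ 2⁻¹) :
    ∫⁻ γ, pathCount G A B γ ∂Measure.pi (fun _ => μ) ≤
      Fintype.card V * (μ A * (2 * (d * μ B))) := by
  have hmeas {x z : V} (p : G.Path x z) : Measurable
      (((p.1.support.toFinset : Set V).pi (Function.update (fun _ => B) x A)).indicator
        (1 : (V → S) → ℝ≥0∞)) :=
    measurable_one.indicator (measurableSet_pi_update hA hB _ x)
  calc ∫⁻ γ, pathCount G A B γ ∂Measure.pi (fun _ => μ)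
      = ∑ x, μ A * ∑ z ∈ Finset.univ.erase x, ∑ p : G.Path x z, μ B ^ p.1.length := by
        unfold pathCount pathCountBetween
        rw [lintegral_finsetSum _ (by fun_prop)]
        refine Finset.sum_congr rfl fun x _ => ?_
        rw [lintegral_finsetSum _ (by fun_prop), Finset.mul_sum]
        refine Finset.sum_congr rfl fun z _ => ?_
        rw [lintegral_finsetSum _ (by fun_prop), Finset.mul_sum]
        refine Finset.sum_congr rfl fun p _ => ?_
        rw [lintegral_indicator_one (measurableSet_pi_update hA hB _ x),
          pi_pi_update_support μ p hA hB]
    _ ≤ ∑ _x : V, μ A * (2 * (d * μ B)) := by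
        gcongr with x
        exact sum_path_pow_length_le hG hd x
    _ = Fintype.card V * (μ A * (2 * (d * μ B))) := by simp

end PathMoments

section ClusterSums

variable {n : ℕ} {β u c : ℝ} {γ : Cube n → ℝ}

/-- The Boltzmann weight `exp (-β √n r)` of a site of the `n`-dimensional cube at which the
environment has the value `r`. -/
def siteWeight (β : ℝ) (n : ℕ) (r : ℝ) : ℝ :=
  Real.exp (-β * (√(n : ℝ) * r))

theorem measurable_siteWeight : Measurable (siteWeight β n) := by
  unfold siteWeight
  fun_prop

/-- The function `r ↦ siteWeight β n r`, set to `0` where it is at least `c`. -/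
def truncatedWeight (β : ℝ) (n : ℕ) (c : ℝ) : ℝ → ℝ≥0∞ :=
  {r | siteWeight β n r < c}.indicator fun r => ENNReal.ofReal (siteWeight β n r)

theorem measurable_truncatedWeight : Measurable (truncatedWeight β n c) :=
  measurable_siteWeight.ennreal_ofReal.indicator
    (measurableSet_lt measurable_siteWeight measurable_const)

open Classical in
/-- The union of the connected components of size at least two of the graph of occupied vertices
that contain a vertex of Boltzmann weight at least `c`. -/
def heavyClusters (β u c : ℝ) (γ : Cube n → ℝ) : Finset (Cube n) :=
  (clusters u γ).filter fun z => ∃ x, c ≤ siteWeight β n (γ x) ∧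
    ∃ p : (cubeGraph n).Walk x z, ∀ y ∈ p.support, y ∈ occupied u γ

theorem mem_heavyClusters {z : Cube n} : z ∈ heavyClusters β u c γ ↔ z ∈ clusters u γ ∧
    ∃ x, c ≤ siteWeight β n (γ x) ∧
      ∃ p : (cubeGraph n).Walk x z, ∀ y ∈ p.support, y ∈ occupied u γ := by
  simp only [heavyClusters, Finset.mem_filter]

theorem heavyClusters_subset : heavyClusters β u c γ ⊆ clusters u γ :=
  fun _ hz => (mem_heavyClusters.mp hz).1

theorem mem_heavyClusters_of_adj {x z : Cube n} (hz : z ∈ heavyClusters β u c γ)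
    (hzx : (cubeGraph n).Adj z x) (hx : x ∈ occupied u γ) : x ∈ heavyClusters β u c γ := by
  obtain ⟨hzc, v, hv, p, hp⟩ := mem_heavyClusters.mp hz
  refine mem_heavyClusters.mpr ⟨mem_clusters.mpr ⟨hx, z, hzx.symm, (mem_clusters.mp hzc).1⟩, v, hv,
    p.concat hzx, ?_⟩
  simp only [SimpleGraph.Walk.support_concat, List.mem_append, List.mem_singleton]
  rintro y (hy | rfl)
  exacts [hp y hy, hx]

theorem siteWeight_lt_of_notMem_heavyClusters {x : Cube n} (hx : x ∈ clusters u γ)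
    (hheavy : x ∉ heavyClusters β u c γ) : siteWeight β n (γ x) < c := by
  by_contra! hle
  refine hheavy (mem_heavyClusters.mpr ⟨hx, x, hle, .nil, ?_⟩)
  simpa using (mem_clusters.mp hx).1

theorem card_heavyClusters_le : ((heavyClusters β u c γ).card : ℝ≥0∞) ≤
    2 * pathCount (cubeGraph n) {r | c ≤ siteWeight β n r} (Iic (-u)) γ := by
  refine card_le_two_mul_pathCount fun z hz => ?_
  obtain ⟨hzc, x, hx, p, hp⟩ := mem_heavyClusters.mp hz
  rcases eq_or_ne x z with rfl | hxz
  · obtain ⟨hxo, y, hxy, hyo⟩ := mem_clusters.mp hzc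
    exact ⟨x, y, hxy.ne, .inl rfl, hx, hxy.toWalk, by
      simp [mem_occupied.mp hxo, mem_occupied.mp hyo]⟩
  · exact ⟨x, z, hxz, .inr rfl, hx, p, fun y hy => mem_occupied.mp (hp y hy)⟩

theorem sum_clusters_le_adjSum {s : Finset (Cube n)} (hs : s ⊆ clusters u γ) {f : ℝ → ℝ≥0∞} :
    ∑ x ∈ s, f (γ x) ≤ adjSum (cubeGraph n) f ((Iic (-u)).indicator 1) γ := by
  refine le_trans ?_ (Finset.sum_le_sum_of_subset s.subset_univ)
  refine Finset.sum_le_sum fun x hx => ?_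
  obtain ⟨_, y, hxy, hy⟩ := mem_clusters.mp (hs hx)
  calc f (γ x) = f (γ x) * (Iic (-u)).indicator 1 (γ y) := by
        rw [indicator_of_mem (mem_Iic.mpr (mem_occupied.mp hy)), Pi.one_apply, mul_one]
    _ ≤ ∑ y ∈ (cubeGraph n).neighborFinset x, f (γ x) * (Iic (-u)).indicator 1 (γ y) :=
        Finset.single_le_sum (f := fun y => f (γ x) * (Iic (-u)).indicator 1 (γ y))
          (fun _ _ => zero_le) (by simpa using hxy)

theorem sum_boltzmann_light_le :
    ∑ x ∈ clusters u γ \ heavyClusters β u c γ, ENNReal.ofReal (boltzmann β γ x) ≤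
      adjSum (cubeGraph n) (truncatedWeight β n c) ((Iic (-u)).indicator 1) γ := by
  refine (Finset.sum_congr rfl fun x hx => ?_).trans_le
    (sum_clusters_le_adjSum Finset.sdiff_subset)
  obtain ⟨hx, hheavy⟩ := Finset.mem_sdiff.mp hx
  have hlight := siteWeight_lt_of_notMem_heavyClusters hx hheavy
  exact (indicator_of_mem (s := {r | siteWeight β n r < c}) hlight
    fun r => ENNReal.ofReal (siteWeight β n r)).symm

theorem card_clusters_le : ((clusters u γ).card : ℝ≥0∞) ≤
    adjSum (cubeGraph n) 1 ((Iic (-u)).indicator 1) γ := by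
  simpa using sum_clusters_le_adjSum (f := 1) subset_rfl

end ClusterSums

section EnvironmentError

variable {n : ℕ} {β u a c : ℝ} {γ : Cube n → ℝ}

/-- A functional of the environment bounding the probability that the rescaled time spent in the
clusters is not small. The three terms control the number of vertices in clusters of large Boltzmann
weight, the total Boltzmann weight of the other clusters, and the number of vertices in clusters. -/
def environmentError (β u a c : ℝ) (γ : Cube n → ℝ) : ℝ≥0∞ :=
  (2 ^ n)⁻¹ *
    (ENNReal.ofReal a * pathCount (cubeGraph n) {r | c ≤ siteWeight β n r} (Iic (-u)) γ +
      ENNReal.ofReal (a * c⁻¹) *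
        adjSum (cubeGraph n) (truncatedWeight β n c) ((Iic (-u)).indicator 1) γ +
      adjSum (cubeGraph n) 1 ((Iic (-u)).indicator 1) γ)

theorem measurableSet_le_siteWeight : MeasurableSet {r | c ≤ siteWeight β n r} :=
  measurableSet_le measurable_const measurable_siteWeight

theorem measurable_heavyPathCount :
    Measurable (pathCount (cubeGraph n) {r | c ≤ siteWeight β n r} (Iic (-u))) :=
  measurable_pathCount measurableSet_le_siteWeight measurableSet_Iic

theorem measurable_occupiedAdjSum {f : ℝ → ℝ≥0∞} (hf : Measurable f) :
    Measurable (adjSum (cubeGraph n) f ((Iic (-u)).indicator 1)) :=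
  measurable_adjSum hf (measurable_one.indicator measurableSet_Iic)

theorem measurable_environmentError : Measurable (environmentError (n := n) β u a c) :=
  (((measurable_heavyPathCount.const_mul _).add
    ((measurable_occupiedAdjSum measurable_truncatedWeight).const_mul _)).add
    (measurable_occupiedAdjSum measurable_one)).const_mul _

theorem lintegral_environmentError (μ : Measure (Cube n → ℝ)) :
    ∫⁻ γ, environmentError β u a c γ ∂μ = (2 ^ n)⁻¹ *
      (ENNReal.ofReal a *
          ∫⁻ γ, pathCount (cubeGraph n) {r | c ≤ siteWeight β n r} (Iic (-u)) γ ∂μ +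
        ENNReal.ofReal (a * c⁻¹) *
          ∫⁻ γ, adjSum (cubeGraph n) (truncatedWeight β n c) ((Iic (-u)).indicator 1) γ ∂μ +
        ∫⁻ γ, adjSum (cubeGraph n) 1 ((Iic (-u)).indicator 1) γ ∂μ) := by
  have hheavy := measurable_heavyPathCount (n := n) (β := β) (u := u) (c := c)
  have hlight := measurable_occupiedAdjSum (n := n) (u := u)
    (measurable_truncatedWeight (β := β) (n := n) (c := c))
  have hoccupied := measurable_occupiedAdjSum (n := n) (u := u) (f := 1) measurable_one
  unfold environmentError
  rw [lintegral_const_mul _ (by fun_prop), lintegral_add_right _ hoccupied,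
    lintegral_add_right _ (hlight.const_mul _), lintegral_const_mul _ hheavy,
    lintegral_const_mul _ hlight]

theorem lintegral_environmentError_le (μ : Measure ℝ) [IsProbabilityMeasure μ] {C : ℝ≥0∞}
    (hu : n * μ (Iic (-u)) ≤ 2⁻¹)
    (hheavy : ENNReal.ofReal a * μ {r | c ≤ siteWeight β n r} ≤ C)
    (hlight : ENNReal.ofReal (a * c⁻¹) * ∫⁻ r, truncatedWeight β n c r ∂μ ≤ C) :
    ∫⁻ γ, environmentError (n := n) β u a c γ ∂Measure.pi (fun _ => μ) ≤
      (3 * C + 1) * (n * μ (Iic (-u))) := by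
  have hreg := cubeGraph_isRegularOfDegree n
  have hindicator : Measurable ((Iic (-u)).indicator (1 : ℝ → ℝ≥0∞)) :=
    measurable_one.indicator measurableSet_Iic
  have hcard : (Fintype.card (Cube n) : ℝ≥0∞) = 2 ^ n := by simp
  rw [lintegral_environmentError, lintegral_adjSum μ hreg measurable_truncatedWeight hindicator,
    lintegral_adjSum μ hreg measurable_one hindicator, lintegral_indicator_one measurableSet_Iic]
  simp only [Pi.one_apply, lintegral_one, measure_univ, one_mul]
  set p := μ (Iic (-u))
  set h := μ {r | c ≤ siteWeight β n r}
  set I := ∫⁻ r, truncatedWeight β n c r ∂μ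
  rw [hcard]
  calc _ ≤ (2 ^ n)⁻¹ * (ENNReal.ofReal a * (2 ^ n * (h * (2 * (n * p)))) +
        ENNReal.ofReal (a * c⁻¹) * (2 ^ n * (I * (n * p))) + 2 ^ n * (n * p)) := by
        gcongr
        exact hcard ▸ lintegral_pathCount_le μ hreg measurableSet_le_siteWeight measurableSet_Iic hu
    _ = ((2 ^ n)⁻¹ * 2 ^ n) * (2 * (ENNReal.ofReal a * h) * (n * p) +
        (ENNReal.ofReal (a * c⁻¹) * I) * (n * p) + n * p) := by ring
    _ ≤ 1 * (2 * C * (n * p) + C * (n * p) + n * p) := by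
        rw [ENNReal.inv_mul_cancel (by simp) (by simp)]
        gcongr
    _ = (3 * C + 1) * (n * p) := by ring

theorem lintegral_comp_environmentError_le {Ω : Type*} [MeasurableSpace Ω] {P : Measure Ω}
    {μ : Measure ℝ} [IsProbabilityMeasure μ] {g : Cube n → Ω → ℝ} (hlaw : ∀ x, HasLaw (g x) μ P)
    (hindep : iIndepFun g P) {C : ℝ≥0∞} (hu : n * μ (Iic (-u)) ≤ 2⁻¹)
    (hheavy : ENNReal.ofReal a * μ {r | c ≤ siteWeight β n r} ≤ C)
    (hlight : ENNReal.ofReal (a * c⁻¹) * ∫⁻ r, truncatedWeight β n c r ∂μ ≤ C) :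
    ∫⁻ ω, environmentError β u a c (fun x => g x ω) ∂P ≤ (3 * C + 1) * (n * μ (Iic (-u))) := by
  have hpi : HasLaw (fun ω x => g x ω) (Measure.pi fun _ => μ) P := hindep.hasLaw_pi hlaw
  rw [hpi.lintegral_comp (f := environmentError β u a c) measurable_environmentError.aemeasurable]
  exact lintegral_environmentError_le μ hu hheavy hlight

theorem two_pow_le_two_mul_card_front (hE : environmentError β u a c γ ≤ 2⁻¹) :
    2 ^ n ≤ 2 * (front u γ).card := by
  have hclusters : ((clusters u γ).card : ℝ≥0∞) * 2 ≤ 2 ^ n := by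
    calc ((clusters u γ).card : ℝ≥0∞) * 2
        = 2 ^ n * ((2 ^ n)⁻¹ * (clusters u γ).card) * 2 := by
          rw [← mul_assoc, ENNReal.mul_inv_cancel (by simp) (by simp), one_mul]
      _ ≤ 2 ^ n * environmentError β u a c γ * 2 := by
          unfold environmentError
          gcongr
          exact le_add_left card_clusters_le
      _ ≤ 2 ^ n * 2⁻¹ * 2 := by gcongr
      _ = 2 ^ n := by rw [mul_assoc, ENNReal.inv_mul_cancel (by simp) (by simp), mul_one]
  have hcard : (front u γ).card = 2 ^ n - (clusters u γ).card := by
    rw [front, Finset.card_sdiff_of_subset (Finset.subset_univ _), Finset.card_univ]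
    simp
  norm_cast at hclusters
  omega

theorem front_nonempty (hE : environmentError β u a c γ ≤ 2⁻¹) : (front u γ).Nonempty := by
  have hpow : 0 < 2 ^ n := by positivity
  have hcard := two_pow_le_two_mul_card_front hE
  exact Finset.card_pos.mp (by omega)

theorem inv_card_front_le (hE : environmentError β u a c γ ≤ 2⁻¹) :
    ((front u γ).card : ℝ≥0∞)⁻¹ ≤ 2 * (2 ^ n)⁻¹ := by
  have hcard : (2 ^ n : ℝ≥0∞) ≤ 2 * (front u γ).card := by
    exact_mod_cast two_pow_le_two_mul_card_front hE
  rw [ENNReal.inv_le_iff_inv_le, ENNReal.mul_inv (by simp) (by simp), inv_inv, mul_comm,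
    ← div_eq_mul_inv]
  exact ENNReal.div_le_of_le_mul' hcard

theorem mul_card_heavyClusters_le_environmentError (hE : environmentError β u a c γ ≤ 2⁻¹) :
    ENNReal.ofReal a * (((front u γ).card : ℝ≥0∞)⁻¹ * (heavyClusters β u c γ).card) ≤
      4 * environmentError β u a c γ := by
  set N := pathCount (cubeGraph n) {r | c ≤ siteWeight β n r} (Iic (-u)) γ
  calc ENNReal.ofReal a * (((front u γ).card : ℝ≥0∞)⁻¹ * (heavyClusters β u c γ).card)
      ≤ ENNReal.ofReal a * (2 * (2 ^ n)⁻¹ * (2 * N)) := by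
        gcongr
        exacts [inv_card_front_le hE, card_heavyClusters_le]
    _ = 4 * ((2 ^ n)⁻¹ * (ENNReal.ofReal a * N)) := by ring
    _ ≤ 4 * environmentError β u a c γ := by
        unfold environmentError
        gcongr
        exact le_self_add.trans le_self_add

theorem mul_sum_boltzmann_le_environmentError (hE : environmentError β u a c γ ≤ 2⁻¹) :
    ENNReal.ofReal (a * c⁻¹) * (((front u γ).card : ℝ≥0∞)⁻¹ *
      ∑ x ∈ clusters u γ \ heavyClusters β u c γ, ENNReal.ofReal (boltzmann β γ x)) ≤
      2 * environmentError β u a c γ := by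
  set L := adjSum (cubeGraph n) (truncatedWeight β n c) ((Iic (-u)).indicator 1) γ
  calc ENNReal.ofReal (a * c⁻¹) * (((front u γ).card : ℝ≥0∞)⁻¹ *
        ∑ x ∈ clusters u γ \ heavyClusters β u c γ, ENNReal.ofReal (boltzmann β γ x))
      ≤ ENNReal.ofReal (a * c⁻¹) * (2 * (2 ^ n)⁻¹ * L) := by
        gcongr
        exacts [inv_card_front_le hE, sum_boltzmann_light_le]
    _ = 2 * ((2 ^ n)⁻¹ * (ENNReal.ofReal (a * c⁻¹) * L)) := by ring
    _ ≤ 2 * environmentError β u a c γ := by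
        unfold environmentError
        gcongr
        exact le_add_self.trans le_self_add

theorem dynamicsLaw_lt_clusterOccupation_le_environmentError (hn : 0 < n) (hu : 0 ≤ u)
    (ha : 0 ≤ a) (hc : 0 < c) (hE : environmentError β u a c γ ≤ 2⁻¹) {δ T : ℝ} (hδ : 0 < δ)
    (hT : 0 ≤ T) :
    dynamicsLaw β u γ {η | ENNReal.ofReal (c * δ) < clusterOccupation β u γ ⌊a * T⌋₊ η} ≤
      ENNReal.ofReal T * (4 + 2 * ENNReal.ofReal δ⁻¹ * ∫⁻ x, ‖x‖ₑ ∂expMeasure 1) *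
        environmentError β u a c γ := by
  have hm : (⌊a * T⌋₊ : ℝ≥0∞) ≤ ENNReal.ofReal T * ENNReal.ofReal a := by
    rw [← ENNReal.ofReal_mul hT, mul_comm T, ← ENNReal.ofReal_natCast]
    exact ENNReal.ofReal_le_ofReal (Nat.floor_le (by positivity))
  have hinv : (ENNReal.ofReal (c * δ))⁻¹ = ENNReal.ofReal c⁻¹ * ENNReal.ofReal δ⁻¹ := by
    rw [← ENNReal.ofReal_inv_of_pos (by positivity), mul_inv, ENNReal.ofReal_mul (by positivity)]
  have hheavy := mul_card_heavyClusters_le_environmentError hE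
  have hlight := mul_sum_boltzmann_le_environmentError hE
  refine (dynamicsLaw_lt_clusterOccupation_le hn hu (front_nonempty hE) heavyClusters_subset
    (fun z hz x => mem_heavyClusters_of_adj (β := β) (c := c) hz) _
    (ENNReal.ofReal_pos.mpr (by positivity)).ne' ENNReal.ofReal_ne_top).trans ?_
  rw [ENNReal.ofReal_mul ha] at hlight
  rw [div_eq_mul_inv, hinv]
  set Z := ((front u γ).card : ℝ≥0∞)⁻¹
  set H := ((heavyClusters β u c γ).card : ℝ≥0∞)
  set L := ∑ x ∈ clusters u γ \ heavyClusters β u c γ, ENNReal.ofReal (boltzmann β γ x)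
  set E := environmentError β u a c γ
  set m₁ := ∫⁻ x, ‖x‖ₑ ∂expMeasure 1
  calc _ ≤ ENNReal.ofReal T * ENNReal.ofReal a * (Z * H) +
        ENNReal.ofReal T * ENNReal.ofReal a * (Z * L) * m₁ *
          (ENNReal.ofReal c⁻¹ * ENNReal.ofReal δ⁻¹) := by gcongr
    _ = ENNReal.ofReal T * (ENNReal.ofReal a * (Z * H)) + ENNReal.ofReal T * ENNReal.ofReal δ⁻¹ *
          m₁ * (ENNReal.ofReal a * ENNReal.ofReal c⁻¹ * (Z * L)) := by ring
    _ ≤ ENNReal.ofReal T * (4 * E) + ENNReal.ofReal T * ENNReal.ofReal δ⁻¹ * m₁ * (2 * E) := by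
        gcongr
    _ = ENNReal.ofReal T * (4 + 2 * ENNReal.ofReal δ⁻¹ * m₁) * E := by ring

end EnvironmentError

/-! ### Truncated exponential moments of the Gaussian law -/

section GaussianTails

theorem gaussianPDFReal_zero_one (x : ℝ) :
    gaussianPDFReal 0 1 x = (√(2 * Real.pi))⁻¹ * Real.exp (-x ^ 2 / 2) := by
  simp [gaussianPDFReal]

theorem measureReal_gaussianReal_Iic_neg_le {s : ℝ} (hs : 0 ≤ s) :
    (gaussianReal 0 1).real (Iic (-s)) ≤ Real.exp (-s ^ 2 / 2) := by
  have hchernoff := measure_le_le_exp_mul_mgf (μ := gaussianReal 0 1) (X := id) (t := -s) (-s)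
    (by linarith) (integrable_exp_mul_gaussianReal _)
  rw [mgf_id_gaussianReal, ← Real.exp_add] at hchernoff
  refine hchernoff.trans (le_of_eq (congrArg Real.exp ?_))
  simp only [NNReal.coe_one]
  ring

theorem le_gaussianReal_Iic_neg {s : ℝ} (hs : 1 ≤ s) :
    ENNReal.ofReal (Real.exp (-(3 / 2)) * gaussianPDFReal 0 1 s / s) ≤
      gaussianReal 0 1 (Iic (-s)) := by
  have hs0 : 0 < s := by linarith
  have hdensity {x : ℝ} (hx : x ∈ Icc (-s - 1 / s) (-s)) :
      Real.exp (-(3 / 2)) * gaussianPDFReal 0 1 s ≤ gaussianPDFReal 0 1 x := by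
    have hdiv : 1 / s ≤ 1 := (div_le_one hs0).mpr hs
    have hcancel : s * (1 / s) = 1 := by field_simp
    have hsquare : (x + s) * (x + s) ≤ 1 := by nlinarith [hx.1, hx.2]
    have hlinear : -s * (x + s) ≤ 1 := by nlinarith [hx.1, hx.2]
    rw [gaussianPDFReal_zero_one, gaussianPDFReal_zero_one, mul_left_comm, ← Real.exp_add]
    gcongr
    nlinarith
  calc ENNReal.ofReal (Real.exp (-(3 / 2)) * gaussianPDFReal 0 1 s / s)
      = ENNReal.ofReal (Real.exp (-(3 / 2)) * gaussianPDFReal 0 1 s) *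
          volume (Icc (-s - 1 / s) (-s)) := by
        rw [Real.volume_Icc, ← ENNReal.ofReal_mul
          (mul_nonneg (Real.exp_pos _).le (gaussianPDFReal_nonneg _ _ _))]
        congr 1
        ring
    _ = ∫⁻ _ in Icc (-s - 1 / s) (-s),
          ENNReal.ofReal (Real.exp (-(3 / 2)) * gaussianPDFReal 0 1 s) :=
        (setLIntegral_const _ _).symm
    _ ≤ ∫⁻ x in Icc (-s - 1 / s) (-s), gaussianPDF 0 1 x :=
        setLIntegral_mono' measurableSet_Icc fun x hx => ENNReal.ofReal_le_ofReal (hdensity hx)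
    _ = gaussianReal 0 1 (Icc (-s - 1 / s) (-s)) := (gaussianReal_apply 0 one_ne_zero _).symm
    _ ≤ gaussianReal 0 1 (Iic (-s)) := measure_mono Icc_subset_Iic_self

theorem measureReal_gaussianReal_Iic_neg_one_pos : 0 < (gaussianReal 0 1).real (Iic (-1)) := by
  have hpdf := gaussianPDFReal_pos 0 1 1 one_ne_zero
  have hpos : 0 < gaussianReal 0 1 (Iic (-1)) :=
    (ENNReal.ofReal_pos.mpr (by positivity)).trans_le (le_gaussianReal_Iic_neg le_rfl)
  exact ENNReal.toReal_pos hpos.ne' (measure_ne_top _ _)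

theorem setLIntegral_exp_gaussianReal_le {b s : ℝ} (hbs : s < b) :
    ∫⁻ x in Ioi (-s), ENNReal.ofReal (Real.exp (-b * x)) ∂gaussianReal 0 1 ≤
      ENNReal.ofReal (Real.exp (b * s) * gaussianPDFReal 0 1 s / (b - s)) := by
  have hdensity (x : ℝ) : gaussianPDFReal 0 1 x * Real.exp (-b * x) ≤
      Real.exp (b * s) * gaussianPDFReal 0 1 s * Real.exp (-(b - s) * (x + s)) := by
    have hexponent : -x ^ 2 / 2 + -b * x ≤ b * s + -s ^ 2 / 2 + -(b - s) * (x + s) := by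
      nlinarith [sq_nonneg (x + s)]
    rw [gaussianPDFReal_zero_one, gaussianPDFReal_zero_one, mul_assoc, ← Real.exp_add,
      mul_left_comm, ← Real.exp_add, mul_assoc, ← Real.exp_add]
    gcongr
  have hintegrable : IntegrableOn (fun x => Real.exp (-(b - s) * (x + s))) (Ioi (-s)) := by
    simp only [mul_add, Real.exp_add]
    exact (integrableOn_exp_mul_Ioi (by linarith) _).mul_const _
  have hintegral : ∫ x in Ioi (-s), Real.exp (-(b - s) * (x + s)) = (b - s)⁻¹ := by
    simp only [mul_add, Real.exp_add]
    rw [integral_mul_const, integral_exp_mul_Ioi (by linarith), div_mul_eq_mul_div, neg_mul,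
      ← Real.exp_add, neg_div_neg_eq, mul_neg, neg_add_cancel, Real.exp_zero, one_div]
  rw [gaussianReal_of_var_ne_zero 0 one_ne_zero, restrict_withDensity measurableSet_Ioi,
    lintegral_withDensity_eq_lintegral_mul _ (measurable_gaussianPDF 0 1) (by fun_prop)]
  calc _ ≤ ∫⁻ x in Ioi (-s), ENNReal.ofReal (Real.exp (b * s) * gaussianPDFReal 0 1 s *
          Real.exp (-(b - s) * (x + s))) := by
        refine lintegral_mono fun x => ?_
        simp only [Pi.mul_apply, gaussianPDF]
        rw [← ENNReal.ofReal_mul (gaussianPDFReal_nonneg _ _ _)]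
        exact ENNReal.ofReal_le_ofReal (hdensity x)
    _ = ENNReal.ofReal (∫ x in Ioi (-s), Real.exp (b * s) * gaussianPDFReal 0 1 s *
          Real.exp (-(b - s) * (x + s))) :=
        (ofReal_integral_eq_lintegral_ofReal (hintegrable.const_mul _) (ae_of_all _ fun x =>
          mul_nonneg (mul_nonneg (Real.exp_pos _).le (gaussianPDFReal_nonneg _ _ _))
            (Real.exp_pos _).le)).symm
    _ = _ := by rw [integral_const_mul, hintegral, div_eq_mul_inv]

theorem setLIntegral_exp_gaussianReal_le_mul {b s : ℝ} (hs : 1 ≤ s) (hbs : s < b) :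
    ∫⁻ x in Ioi (-s), ENNReal.ofReal (Real.exp (-b * x)) ∂gaussianReal 0 1 ≤
      ENNReal.ofReal (Real.exp (3 / 2) * (s / (b - s)) * Real.exp (b * s)) *
        gaussianReal 0 1 (Iic (-s)) := by
  have hbs' : 0 < b - s := sub_pos.mpr hbs
  have hs0 : s ≠ 0 := by positivity
  have hexp : Real.exp (3 / 2) * Real.exp (-(3 / 2)) = 1 := by rw [← Real.exp_add]; simp
  calc ∫⁻ x in Ioi (-s), ENNReal.ofReal (Real.exp (-b * x)) ∂gaussianReal 0 1
      ≤ ENNReal.ofReal (Real.exp (b * s) * gaussianPDFReal 0 1 s / (b - s)) :=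
        setLIntegral_exp_gaussianReal_le hbs
    _ = ENNReal.ofReal ((Real.exp (3 / 2) * Real.exp (-(3 / 2))) *
          (Real.exp (b * s) * gaussianPDFReal 0 1 s / (b - s))) := by rw [hexp, one_mul]
    _ = ENNReal.ofReal (Real.exp (3 / 2) * (s / (b - s)) * Real.exp (b * s)) *
          ENNReal.ofReal (Real.exp (-(3 / 2)) * gaussianPDFReal 0 1 s / s) := by
        rw [← ENNReal.ofReal_mul (by positivity)]
        congr 1
        field_simp [hs0]
    _ ≤ _ := by
        gcongr
        exact le_gaussianReal_Iic_neg hs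

end GaussianTails

section TruncatedMoment

variable {n : ℕ} {β c : ℝ}

theorem setOf_le_siteWeight (hn : 0 < n) (hβ : 0 < β) (hc : 0 < c) :
    {r | c ≤ siteWeight β n r} = Iic (-(Real.log c / (β * √n))) := by
  have hb : 0 < β * √(n : ℝ) := by positivity
  ext r
  rw [mem_ofPred_eq, mem_Iic, siteWeight, ← Real.log_le_iff_le_exp hc, ← neg_div, le_div_iff₀ hb]
  constructor <;> intro h <;> linarith

theorem lintegral_truncatedWeight (μ : Measure ℝ) (hn : 0 < n) (hβ : 0 < β) (hc : 0 < c) :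
    ∫⁻ r, truncatedWeight β n c r ∂μ =
      ∫⁻ r in Ioi (-(Real.log c / (β * √n))), ENNReal.ofReal (Real.exp (-(β * √n) * r)) ∂μ := by
  have hset : {r | siteWeight β n r < c} = Ioi (-(Real.log c / (β * √n))) := by
    rw [← compl_Iic, ← setOf_le_siteWeight hn hβ hc]
    ext r
    simp
  rw [truncatedWeight, hset, lintegral_indicator measurableSet_Ioi]
  simp only [siteWeight, neg_mul, mul_assoc]

theorem mul_lintegral_truncatedWeight_le (hn : 0 < n) {ρ : ℝ} (hβ : 0 < β) (hρ : ρ < β)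
    (hc : 0 < c) (hlow : 1 ≤ Real.log c / (β * √n)) (hhigh : Real.log c / (β * √n) ≤ ρ * √n)
    {a : ℝ} (ha : 0 ≤ a) :
    ENNReal.ofReal (a * c⁻¹) * ∫⁻ r, truncatedWeight β n c r ∂gaussianReal 0 1 ≤
      ENNReal.ofReal (Real.exp (3 / 2) * (ρ / (β - ρ))) *
        (ENNReal.ofReal a * gaussianReal 0 1 {r | c ≤ siteWeight β n r}) := by
  rw [lintegral_truncatedWeight _ hn hβ hc, setOf_le_siteWeight hn hβ hc]
  have hsqrt : 0 < √(n : ℝ) := by positivity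
  have hcs : Real.exp (β * √n * (Real.log c / (β * √n))) = c := by
    rw [mul_div_cancel₀ _ (by positivity), Real.exp_log hc]
  set s := Real.log c / (β * √n)
  have hgap : (β - ρ) * √n ≤ β * √n - s := by linarith
  have hβρ : 0 < β - ρ := sub_pos.mpr hρ
  have hgap0 : 0 < β * √n - s := lt_of_lt_of_le (by positivity) hgap
  have hratio : s / (β * √n - s) ≤ ρ / (β - ρ) := by
    rw [div_le_div_iff₀ hgap0 hβρ]
    nlinarith [hsqrt]
  calc _ ≤ ENNReal.ofReal (a * c⁻¹) * (ENNReal.ofReal (Real.exp (3 / 2) * (s / (β * √n - s)) *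
          Real.exp (β * √n * s)) * gaussianReal 0 1 (Iic (-s))) := by
        gcongr
        exact setLIntegral_exp_gaussianReal_le_mul hlow (by linarith)
    _ = ENNReal.ofReal (Real.exp (3 / 2) * (s / (β * √n - s))) *
          (ENNReal.ofReal a * gaussianReal 0 1 (Iic (-s))) := by
        rw [hcs, ← mul_assoc, ← mul_assoc, ← ENNReal.ofReal_mul (by positivity),
          ← ENNReal.ofReal_mul (by positivity)]
        congr 2
        field_simp
    _ ≤ _ := by gcongr

theorem pos_of_measureReal_le_siteWeight_lt_one {μ : Measure ℝ} [IsProbabilityMeasure μ]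
    (h : μ.real {r | c ≤ siteWeight β n r} < 1) : 0 < c := by
  by_contra! hc
  have huniv : {r | c ≤ siteWeight β n r} = univ :=
    eq_univ_of_forall fun r => hc.trans (Real.exp_pos _).le
  simp [huniv] at h

theorem le_mul_sqrt_of_inv_le_gaussianReal {a s ρ : ℝ} (ha : 0 < a) (hρ : 0 ≤ ρ) (hs : 0 ≤ s)
    (hlog : 2 * Real.log (2 * a) ≤ ρ ^ 2 * n)
    (hle : (2 * a)⁻¹ ≤ (gaussianReal 0 1).real (Iic (-s))) : s ≤ ρ * √n := by
  have hexponent := Real.log_le_log (by positivity)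
    (hle.trans (measureReal_gaussianReal_Iic_neg_le hs))
  rw [Real.log_exp, Real.log_inv] at hexponent
  refine abs_le_of_sq_le_sq' ?_ (by positivity) |>.2
  rw [mul_pow, Real.sq_sqrt (by positivity)]
  linarith

end TruncatedMoment

section Scales

variable {a c : ℕ → ℝ} {ε : ℝ}

theorem tendsto_atTop_of_tendsto_log_div (hε : 0 < ε) (hpos : ∀ᶠ n in atTop, 0 < a n)
    (ha : Tendsto (fun n : ℕ => Real.log (a n) / ((n : ℝ) * Real.log 2)) atTop (𝓝 ε)) :
    Tendsto a atTop atTop := by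
  have hscale : Tendsto (fun n : ℕ => (n : ℝ) * Real.log 2) atTop atTop :=
    tendsto_natCast_atTop_atTop.atTop_mul_const (Real.log_pos one_lt_two)
  refine (Real.tendsto_exp_atTop.comp (ha.pos_mul_atTop hε hscale)).congr' ?_
  filter_upwards [hpos, eventually_gt_atTop 0] with n hn hn0
  have hscale0 : (n : ℝ) * Real.log 2 ≠ 0 := by positivity
  rw [Function.comp_apply, div_mul_cancel₀ _ hscale0, Real.exp_log hn]

theorem eventually_two_mul_log_two_mul_le {ρ : ℝ} (hρ : ε * 2 * Real.log 2 < ρ ^ 2)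
    (hpos : ∀ᶠ n in atTop, 0 < a n)
    (ha : Tendsto (fun n : ℕ => Real.log (a n) / ((n : ℝ) * Real.log 2)) atTop (𝓝 ε)) :
    ∀ᶠ n : ℕ in atTop, 2 * Real.log (2 * a n) ≤ ρ ^ 2 * n := by
  have hlim : Tendsto (fun n : ℕ => 2 * Real.log 2 * (Real.log (a n) / ((n : ℝ) * Real.log 2)) +
      2 * Real.log 2 / (n : ℝ)) atTop (𝓝 (2 * Real.log 2 * ε + 0)) :=
    (ha.const_mul _).add (tendsto_const_nhds.div_atTop tendsto_natCast_atTop_atTop)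
  filter_upwards [hlim.eventually (gt_mem_nhds (show _ < ρ ^ 2 by linarith)), hpos,
    eventually_gt_atTop 0] with n hlt hn hn0
  have hn0' : (0 : ℝ) < n := by positivity
  have hsum : 2 * Real.log 2 * (Real.log (a n) / ((n : ℝ) * Real.log 2)) + 2 * Real.log 2 / n =
      2 * (Real.log 2 + Real.log (a n)) / n := by
    have hlog2 : Real.log 2 ≠ 0 := (Real.log_pos one_lt_two).ne'
    field_simp
    ring
  rw [hsum, div_lt_iff₀ hn0'] at hlt
  rw [Real.log_mul two_ne_zero hn.ne']
  exact hlt.le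

theorem eventually_level_mem_Icc {β ρ : ℝ} (hε : 0 < ε) (hβ : 0 < β) (hρ0 : 0 ≤ ρ)
    (hρ : ε * 2 * Real.log 2 < ρ ^ 2)
    (ha : Tendsto (fun n : ℕ => Real.log (a n) / ((n : ℝ) * Real.log 2)) atTop (𝓝 ε))
    (hac : Tendsto (fun n => a n * (gaussianReal 0 1).real {r | c n ≤ siteWeight β n r})
      atTop (𝓝 1)) :
    ∀ᶠ n : ℕ in atTop, 0 < a n ∧ 0 < c n ∧
      Real.log (c n) / (β * √n) ∈ Icc 1 (ρ * √n) := by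
  set p : ℕ → ℝ := fun n => (gaussianReal 0 1).real {r | c n ≤ siteWeight β n r} with hp
  have hpos : ∀ᶠ n in atTop, 0 < a n := by
    filter_upwards [hac.eventually (lt_mem_nhds zero_lt_one)] with n hn
    exact pos_of_mul_pos_left hn measureReal_nonneg
  have hp0 : Tendsto p atTop (𝓝 0) := by
    refine (hac.div_atTop (tendsto_atTop_of_tendsto_log_div hε hpos ha)).congr' ?_
    filter_upwards [hpos] with n hn
    rw [mul_div_cancel_left₀ _ hn.ne']
  filter_upwards [hpos, eventually_two_mul_log_two_mul_le hρ hpos ha,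
    hp0.eventually (gt_mem_nhds measureReal_gaussianReal_Iic_neg_one_pos),
    hac.eventually (lt_mem_nhds one_half_lt_one), eventually_gt_atTop 0]
    with n han hlog hsmall hhalf hn
  have hc : 0 < c n := pos_of_measureReal_le_siteWeight_lt_one (hsmall.trans_le measureReal_le_one)
  simp only [hp, setOf_le_siteWeight hn hβ hc] at hsmall hhalf
  have hlow : 1 ≤ Real.log (c n) / (β * √n) := by
    by_contra! hlt
    exact hsmall.not_ge (measureReal_mono (Iic_subset_Iic.mpr (by linarith)))
  refine ⟨han, hc, hlow, le_mul_sqrt_of_inv_le_gaussianReal han hρ0 (by linarith) hlog ?_⟩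
  rw [inv_le_iff_one_le_mul₀ (by positivity)]
  linarith

theorem exists_truncatedWeight_bound {β : ℝ} (hε : 0 < ε) (hβ : betaC ε < β)
    (ha : Tendsto (fun n : ℕ => Real.log (a n) / ((n : ℝ) * Real.log 2)) atTop (𝓝 ε))
    (hac : Tendsto (fun n => a n * (gaussianReal 0 1).real {r | c n ≤ siteWeight β n r})
      atTop (𝓝 1)) :
    ∃ C : ℝ≥0∞, C ≠ ∞ ∧ ∀ᶠ n : ℕ in atTop, 0 < a n ∧ 0 < c n ∧
      ENNReal.ofReal (a n) * gaussianReal 0 1 {r | c n ≤ siteWeight β n r} ≤ C ∧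
      ENNReal.ofReal (a n * (c n)⁻¹) *
        ∫⁻ r, truncatedWeight β n (c n) r ∂gaussianReal 0 1 ≤ C := by
  have hβ0 : 0 < β := (Real.sqrt_nonneg _).trans_lt hβ
  obtain ⟨ρ, hερ, hρβ⟩ := exists_between hβ
  have hρ0 : 0 < ρ := (Real.sqrt_nonneg _).trans_lt hερ
  set K := ENNReal.ofReal (Real.exp (3 / 2) * (ρ / (β - ρ)))
  refine ⟨max 2 (K * 2), max_ne_top ENNReal.ofNat_ne_top
    (ENNReal.mul_ne_top ENNReal.ofReal_ne_top ENNReal.ofNat_ne_top), ?_⟩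
  filter_upwards [eventually_level_mem_Icc hε hβ0 hρ0.le ((Real.sqrt_lt' hρ0).mp hερ) ha hac,
    hac.eventually (gt_mem_nhds one_lt_two), eventually_gt_atTop 0]
    with n ⟨han, hcn, hlow, hhigh⟩ hlt hn
  have hheavy : ENNReal.ofReal (a n) * gaussianReal 0 1 {r | c n ≤ siteWeight β n r} ≤ 2 := by
    rw [← ofReal_measureReal, ← ENNReal.ofReal_mul han.le,
      ENNReal.ofReal_le_iff_le_toReal (by simp)]
    simpa using hlt.le
  refine ⟨han, hcn, hheavy.trans (le_max_left _ _), ?_⟩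
  calc _ ≤ K * (ENNReal.ofReal (a n) * gaussianReal 0 1 {r | c n ≤ siteWeight β n r}) :=
        mul_lintegral_truncatedWeight_le hn hβ0 hρβ hcn hlow hhigh han.le
    _ ≤ K * 2 := by gcongr
    _ ≤ _ := le_max_right _ _

end Scales

/-! ### Almost sure convergence -/

theorem ae_tendsto_zero_of_lintegral_le {Ω : Type*} [MeasurableSpace Ω] {P : Measure Ω}
    {f : ℕ → Ω → ℝ≥0∞} (hf : ∀ n, AEMeasurable (f n) P) {b : ℕ → ℝ≥0∞}
    (hb : ∀ᶠ n in atTop, ∫⁻ ω, f n ω ∂P ≤ b n) (hsum : ∑' n, b n ≠ ∞) :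
    ∀ᵐ ω ∂P, Tendsto (fun n => f n ω) atTop (𝓝 0) := by
  obtain ⟨N, hN⟩ := eventually_atTop.mp hb
  have hfinite : ∫⁻ ω, ∑' n, f (n + N) ω ∂P ≠ ∞ := by
    rw [lintegral_tsum fun n => hf (n + N)]
    refine ne_top_of_le_ne_top hsum ?_
    calc ∑' n, ∫⁻ ω, f (n + N) ω ∂P ≤ ∑' n, b (n + N) :=
          ENNReal.tsum_le_tsum fun n => hN (n + N) (by omega)
      _ ≤ ∑' n, b n := ENNReal.tsum_comp_le_tsum_of_injective (add_left_injective N) b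
  filter_upwards [ae_lt_top' (AEMeasurable.tsum fun n => hf (n + N)) hfinite] with ω hω
  rw [← tendsto_add_atTop_iff_nat N]
  exact ENNReal.tendsto_atTop_zero_of_tsum_ne_top hω.ne

section OccupationProbability

variable {μ : Measure ℝ} {u : ℕ → ℝ} {cstar : ℝ}

theorem natCast_mul_measure_eq_ofReal_rpow [IsFiniteMeasure μ] {s : Set ℝ} {n : ℕ} (hn : n ≠ 0)
    (h : μ.real s = (n : ℝ) ^ (-cstar)) : n * μ s = ENNReal.ofReal ((n : ℝ) ^ (1 - cstar)) := by
  have hn0 : (0 : ℝ) < n := by positivity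
  rw [← ofReal_measureReal, h, ← ENNReal.ofReal_natCast, ← ENNReal.ofReal_mul hn0.le,
    sub_eq_add_neg, Real.rpow_add hn0, Real.rpow_one]

theorem tendsto_natCast_rpow_neg {s : ℝ} (hs : s < 0) :
    Tendsto (fun n : ℕ => (n : ℝ) ^ s) atTop (𝓝 0) := by
  have h := tendsto_rpow_neg_atTop (neg_pos.mpr hs)
  rw [neg_neg] at h
  exact h.comp tendsto_natCast_atTop_atTop

theorem eventually_nonneg_of_measureReal_Iic_neg [IsFiniteMeasure μ] (h0 : 0 < μ.real (Iic 0))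
    (hcstar : 0 < cstar) (hu : ∀ᶠ n : ℕ in atTop, μ.real (Iic (-u n)) = (n : ℝ) ^ (-cstar)) :
    ∀ᶠ n in atTop, 0 ≤ u n := by
  filter_upwards [hu, (tendsto_natCast_rpow_neg (neg_neg_of_pos hcstar)).eventually
    (gt_mem_nhds h0)] with n hn hlt
  by_contra! hneg
  rw [← hn] at hlt
  exact hlt.not_ge (measureReal_mono (Iic_subset_Iic.mpr (by linarith)))

end OccupationProbability

section Conclusion

variable {β : ℝ} {u a c : ℕ → ℝ}

theorem ae_tendsto_environmentError {Ω : Type*} [MeasurableSpace Ω] {P : Measure Ω}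
    {μ : Measure ℝ} [IsProbabilityMeasure μ] {g : (n : ℕ) → Cube n → Ω → ℝ}
    (hlaw : ∀ n x, HasLaw (g n x) μ P) (hindep : ∀ n, iIndepFun (g n) P) {cstar : ℝ}
    (hcstar : 2 < cstar)
    (hu : ∀ᶠ n : ℕ in atTop, μ.real (Iic (-u n)) = (n : ℝ) ^ (-cstar)) {C : ℝ≥0∞} (hC : C ≠ ∞)
    (hheavy : ∀ᶠ n in atTop, ENNReal.ofReal (a n) * μ {r | c n ≤ siteWeight β n r} ≤ C)
    (hlight : ∀ᶠ n in atTop,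
      ENNReal.ofReal (a n * (c n)⁻¹) * ∫⁻ r, truncatedWeight β n (c n) r ∂μ ≤ C) :
    ∀ᵐ ω ∂P, Tendsto (fun n => environmentError β (u n) (a n) (c n) fun x => g n x ω)
      atTop (𝓝 0) := by
  have hzero : Tendsto (fun n : ℕ => ENNReal.ofReal ((n : ℝ) ^ (1 - cstar))) atTop (𝓝 0) := by
    simpa using ENNReal.tendsto_ofReal (tendsto_natCast_rpow_neg (s := 1 - cstar) (by linarith))
  have hsummable : Summable fun n : ℕ => (n : ℝ) ^ (1 - cstar) :=
    Real.summable_nat_rpow.mpr (by linarith)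
  refine ae_tendsto_zero_of_lintegral_le
    (b := fun n => (3 * C + 1) * ENNReal.ofReal ((n : ℝ) ^ (1 - cstar)))
    (fun n => measurable_environmentError.comp_aemeasurable
      (aemeasurable_pi_lambda _ fun x => (hlaw n x).aemeasurable)) ?_ ?_
  · filter_upwards [hu, hheavy, hlight, eventually_ne_atTop 0,
      hzero.eventually (gt_mem_nhds (show (0 : ℝ≥0∞) < 2⁻¹ by simp))]
      with n hun hheavy hlight hn hlt
    rw [← natCast_mul_measure_eq_ofReal_rpow hn hun] at hlt ⊢
    exact lintegral_comp_environmentError_le (hlaw n) (hindep n) hlt.le hheavy hlight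
  · rw [ENNReal.tsum_mul_left]
    exact ENNReal.mul_ne_top (by finiteness) hsummable.tsum_ofReal_ne_top

variable {γ : (n : ℕ) → Cube n → ℝ}

theorem tendsto_dynamicsLaw_lt_clusterOccupation
    (hE : Tendsto (fun n => environmentError β (u n) (a n) (c n) (γ n)) atTop (𝓝 0))
    (hu : ∀ᶠ n in atTop, 0 ≤ u n) (ha : ∀ᶠ n in atTop, 0 < a n) (hc : ∀ᶠ n in atTop, 0 < c n)
    {δ T : ℝ} (hδ : 0 < δ) (hT : 0 ≤ T) :
    Tendsto (fun n => dynamicsLaw β (u n) (γ n)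
      {η | ENNReal.ofReal (c n * δ) < clusterOccupation β (u n) (γ n) ⌊a n * T⌋₊ η})
      atTop (𝓝 0) := by
  have hmean : ∫⁻ x, ‖x‖ₑ ∂expMeasure 1 ≠ ∞ := (integrable_id_expMeasure one_pos).2.ne
  have hbound := ENNReal.Tendsto.const_mul
    (a := ENNReal.ofReal T * (4 + 2 * ENNReal.ofReal δ⁻¹ * ∫⁻ x, ‖x‖ₑ ∂expMeasure 1))
    hE (.inr (by finiteness))
  rw [mul_zero] at hbound
  refine tendsto_of_tendsto_of_tendsto_of_le_of_le' tendsto_const_nhds hbound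
    (.of_forall fun _ => zero_le) ?_
  filter_upwards [hE.eventually (gt_mem_nhds (show (0 : ℝ≥0∞) < 2⁻¹ by simp)), hu, ha, hc,
    eventually_gt_atTop 0] with n hEn hun han hcn hn
  exact dynamicsLaw_lt_clusterOccupation_le_environmentError hn hun han.le hcn hEn.le hδ hT

theorem tendsto_dynamicsLaw_lt_clusterTime
    (hE : Tendsto (fun n => environmentError β (u n) (a n) (c n) (γ n)) atTop (𝓝 0))
    (hu : ∀ᶠ n in atTop, 0 ≤ u n) (ha : ∀ᶠ n in atTop, 0 < a n) (hc : ∀ᶠ n in atTop, 0 < c n)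
    {δ : ℝ} (hδ : 0 < δ) (t : ℝ≥0) :
    Tendsto (fun n => dynamicsLaw β (u n) (γ n)
      {η | δ < clusterTime β (u n) (a n) (c n) (γ n) η t}) atTop (𝓝 0) := by
  refine tendsto_of_tendsto_of_tendsto_of_le_of_le' tendsto_const_nhds
    (tendsto_dynamicsLaw_lt_clusterOccupation hE hu ha hc hδ t.2) (.of_forall fun _ => zero_le) ?_
  filter_upwards [hc] with n hcn
  refine measure_mono fun η hη => ?_
  contrapose! hη
  simp only [mem_ofPred_eq, not_lt] at hη ⊢
  exact (le_abs_self _).trans (abs_clusterTime_le hcn hδ.le hη)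

theorem tendsto_dynamicsLaw_lt_skorokhodDist
    (hE : Tendsto (fun n => environmentError β (u n) (a n) (c n) (γ n)) atTop (𝓝 0))
    (hu : ∀ᶠ n in atTop, 0 ≤ u n) (ha : ∀ᶠ n in atTop, 0 < a n) (hc : ∀ᶠ n in atTop, 0 < c n)
    {δ : ℝ} (hδ : 0 < δ) :
    Tendsto (fun n => dynamicsLaw β (u n) (γ n) {η | ENNReal.ofReal δ < skorokhodDist
      (rescaledClock β (u n) (a n) (c n) (γ n) η)
      (rescaledFrontClock β (u n) (a n) (c n) (γ n) η)}) atTop (𝓝 0) := by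
  have hδ2 : 0 < δ / 2 := half_pos hδ
  obtain ⟨M, hM⟩ := ENNReal.exists_inv_two_pow_lt (ENNReal.ofReal_pos.mpr hδ2).ne'
  refine tendsto_of_tendsto_of_tendsto_of_le_of_le' tendsto_const_nhds
    (tendsto_dynamicsLaw_lt_clusterOccupation hE hu ha hc hδ2 M.cast_nonneg)
    (.of_forall fun _ => zero_le) ?_
  filter_upwards [hE.eventually (gt_mem_nhds (show (0 : ℝ≥0∞) < 2⁻¹ by simp)), hu, ha, hc,
    eventually_gt_atTop 0] with n hEn hun han hcn hn
  refine measure_mono_ae ?_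
  filter_upwards [ae_dynamicsLaw_infinite_front (β := β) hn hun (front_nonempty hEn.le)] with η hη
  refine fun hlt => not_le.mp fun hle => not_le.mpr hlt ?_
  calc _ ≤ ENNReal.ofReal (δ / 2) + 2⁻¹ ^ M :=
        skorokhodDist_rescaledClock_le han.le hcn hδ2.le hη hle
    _ ≤ ENNReal.ofReal (δ / 2) + ENNReal.ofReal (δ / 2) := by gcongr
    _ = ENNReal.ofReal δ := by rw [← ENNReal.ofReal_add hδ2.le hδ2.le, add_halves]

end Conclusion

end TruncatedREM

end

theorem theorem3p3_general {Ω : Type*} [MeasurableSpace Ω] (P : Measure Ω)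
    (g : (n : ℕ) → Cube n → Ω → ℝ)
    (hg_law : ∀ n x, HasLaw (g n x) (gaussianReal 0 1) P)
    (hg_indep : ∀ n, iIndepFun (g n) P)
    (cstar : ℝ) (hcstar : 2 < cstar)
    (u : ℕ → ℝ)
    (hu : ∀ n, 2 ≤ n → ∀ x, P.real {ω | g n x ω ≤ -u n} = (n : ℝ) ^ (-cstar))
    (ε : ℝ) (hε : 0 < ε) (β : ℝ) (hβ : betaC ε < β)
    (a c : ℕ → ℝ)
    (ha : Tendsto (fun n : ℕ => Real.log (a n) / ((n : ℝ) * Real.log 2)) atTop (𝓝 ε))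
    (hac : ∀ x : (n : ℕ) → Cube n,
      Tendsto (fun n => a n * P.real {ω | c n ≤ boltzmann β (fun y => g n y ω) (x n)})
        atTop (𝓝 1)) :
    ∀ᵐ ω ∂P, ∀ δ : ℝ, 0 < δ →
      Tendsto (fun n => dynamicsLaw β (u n) (fun y => g n y ω)
        {η | ENNReal.ofReal δ < skorokhodDist
          (rescaledClock β (u n) (a n) (c n) (fun y => g n y ω) η)
          (rescaledFrontClock β (u n) (a n) (c n) (fun y => g n y ω) η)}) atTop (𝓝 0) ∧
      ∀ t : ℝ≥0, Tendsto (fun n => dynamicsLaw β (u n) (fun y => g n y ω)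
        {η | δ < clusterTime β (u n) (a n) (c n) (fun y => g n y ω) η t}) atTop (𝓝 0) := by
  have hlevel : Tendsto (fun n => a n * (gaussianReal 0 1).real {r | c n ≤ siteWeight β n r})
      atTop (𝓝 1) := by
    refine (hac fun _ => 1).congr fun n => ?_
    rw [← (hg_law n 1).measureReal_eq (p := fun r => c n ≤ siteWeight β n r)
      measurableSet_le_siteWeight]
    rfl
  obtain ⟨C, hC, hbound⟩ := exists_truncatedWeight_bound hε hβ ha hlevel
  obtain ⟨ha0, hc0, hheavy, hlight⟩ : _ ∧ _ ∧ _ ∧ _ := by simpa only [eventually_and] using hbound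
  have hocc : ∀ᶠ n : ℕ in atTop, (gaussianReal 0 1).real (Iic (-u n)) = (n : ℝ) ^ (-cstar) := by
    filter_upwards [eventually_ge_atTop 2] with n hn
    rw [← hu n hn 1]
    exact ((hg_law n 1).measureReal_eq (p := fun r => r ≤ -u n) measurableSet_Iic).symm
  have hu0 : ∀ᶠ n in atTop, 0 ≤ u n :=
    eventually_nonneg_of_measureReal_Iic_neg (measureReal_gaussianReal_Iic_neg_one_pos.trans_le
      (measureReal_mono (Iic_subset_Iic.mpr (by norm_num)))) (by linarith) hocc
  filter_upwards [ae_tendsto_environmentError hg_law hg_indep hcstar hocc hC hheavy hlight]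
    with ω hE δ hδ
  exact ⟨tendsto_dynamicsLaw_lt_skorokhodDist hE hu0 ha0 hc0 hδ,
    tendsto_dynamicsLaw_lt_clusterTime hE hu0 ha0 hc0 hδ⟩

theorem theorem3p3 {Ω : Type*} [MeasurableSpace Ω] (P : Measure Ω) [IsProbabilityMeasure P]
    (g : (n : ℕ) → Cube n → Ω → ℝ)
    (hg_law : ∀ n x, HasLaw (g n x) (gaussianReal 0 1) P)
    (hg_indep : ∀ n, iIndepFun (g n) P)
    (cstar : ℝ) (hcstar : 2 < cstar)
    (u : ℕ → ℝ)
    (hu : ∀ n, 2 ≤ n → ∀ x, P.real {ω | g n x ω ≤ -u n} = (n : ℝ) ^ (-cstar))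
    (ε : ℝ) (hε0 : 0 < ε) (hε1 : ε < 1) (β : ℝ) (hβ : betaC ε < β)
    (a c : ℕ → ℝ)
    (ha : Tendsto (fun n : ℕ => Real.log (a n) / ((n : ℝ) * Real.log 2)) atTop (𝓝 ε))
    (hac : ∀ x : (n : ℕ) → Cube n,
      Tendsto (fun n => a n * P.real {ω | c n ≤ boltzmann β (fun y => g n y ω) (x n)})
        atTop (𝓝 1)) :
    ∀ᵐ ω ∂P, ∀ δ : ℝ, 0 < δ →
      Tendsto (fun n => dynamicsLaw β (u n) (fun y => g n y ω)
        {η | ENNReal.ofReal δ < skorokhodDist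
          (rescaledClock β (u n) (a n) (c n) (fun y => g n y ω) η)
          (rescaledFrontClock β (u n) (a n) (c n) (fun y => g n y ω) η)}) atTop (𝓝 0) ∧
      ∀ t : ℝ≥0, Tendsto (fun n => dynamicsLaw β (u n) (fun y => g n y ω)
        {η | δ < clusterTime β (u n) (a n) (c n) (fun y => g n y ω) η t}) atTop (𝓝 0) :=
  theorem3p3_general P g hg_law hg_indep cstar hcstar u hu ε hε0 β hβ a c ha hac
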